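/- Let $A\in\mathbb{R}^{m\times n}$ and $p\le n$, and let $\mathrm{St}(n,p)=\{X\in\mathbb{R}^{n\times p}: X^{\top}X=I_p\}$. For a real symmetric $p\times p$ matrix $B$ let $s_q(B)$, $0\le q\le p$, be the $q$-th elementary symmetric polynomial of the eigenvalues of $B$, i.e. the coefficient of $t^q$ in $\det(I_p+tB)$. Let $w_0,\dots,w_p\ge 0$, put $g_w=\sum_{q=0}^p w_q s_q$ and $$f(X)=\frac{g_w(X^{\top}A^{\top}AX)}{g_w(X^{\top}X)} ,$$ and assume that $w_q\neq 0$ for some $q$ with $1\le q\le \min(p,\operatorname{rank}A)$. Consider the problem of maximising $f$ over $\mathrm{St}(n,p)$. (i) A matrix $X\in\mathrm{St}(n,p)$ is a global maximiser if and only if $\operatorname{range}(X)=\operatorname{range}(V_p)$ for some $p$-leading right singular factor $V_p$ of $A$, i.e. some $V_p$ formed by the first $p$ columns of $V$ in a singular value decomposition $A=U\Sigma V^{\top}$ ($U,V$ orthogonal, singular values in nonincreasing order). (ii) Every local maximiser is a global maximiser. Moreover, let $X$ be any other stationary point, such that $\operatorname{rank}(AX)\ge q-1$ for some $q\ge 1$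 with $w_q\ne 0$ (this holds automatically if $w_1\neq 0$ or if $X^{\top}A^{\top}AX$ is invertible). Then $X$ is a strict saddle point: it has an ascent direction, and it also has a descent direction unless it is a local minimiser. Here, with $L_\Lambda(X)=f(X)+\langle X^{\top}X-I_p,\Lambda\rangle$, a point $X\in\mathrm{St}(n,p)$ is stationary if $\nabla L_\Lambda(X)=\nabla f(X)+X(\Lambda+\Lambda^{\top})=0$ for some $\Lambda\in\mathbb{R}^{p\times p}$; an ascent (descent) direction at a stationary point $X$ is a $\Delta\in\mathbb{R}^{n\times p}$ with $X^{\top}\Delta+\Delta^{\top}X=0$ and $\nabla^2L_\Lambda(X)[\Delta,\Delta]>0$ (respectively $<0$) for such a $\Lambda$. -/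

import Mathlib

open Matrix Polynomial

noncomputable section

/-- The `q`-th elementary symmetric polynomial `s_q(B)` of the eigenvalues of a square matrix `B`,
namely the coefficient of `t ^ q` in `det (I + t B)`. -/
def esymmMatrix {p : ℕ} (q : ℕ) (B : Matrix (Fin p) (Fin p) ℝ) : ℝ :=
  (det (1 + (X : ℝ[X]) • B.map C)).coeff q

/-- On symmetric matrices `s_q` is the sum of all products of `q` eigenvalues. -/
theorem esymmMatrix_eq_sum_eigenvalues {p : ℕ} (q : ℕ) {B : Matrix (Fin p) (Fin p) ℝ}
    (hB : B.IsHermitian) :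
    esymmMatrix q B = ∑ s ∈ Finset.powersetCard q Finset.univ, ∏ i ∈ s, hB.eigenvalues i := by
  have key : det (1 + (X : ℝ[X]) • B.map C) = ∏ i, (1 + X * C (hB.eigenvalues i)) := by
    apply Polynomial.funext
    intro t
    have h1 : (det (1 + (X : ℝ[X]) • B.map C)).eval t = det (1 + t • B) := by
      rw [← Polynomial.coe_evalRingHom, RingHom.map_det]
      congr 1
      ext i j
      simp [Matrix.one_apply]
      split_ifs <;> simp [mul_comm]
    rw [h1]
    have hs := hB.spectral_theorem
    set U : Matrix (Fin p) (Fin p) ℝ := (hB.eigenvectorUnitary : Matrix (Fin p) (Fin p) ℝ)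
    have hU : U * star U = 1 := by
      exact Matrix.mem_unitaryGroup_iff.mp hB.eigenvectorUnitary.2
    have hs' : B = U * diagonal hB.eigenvalues * star U := by
      simpa [Unitary.conjStarAlgAut_apply, Function.comp_def] using hs
    have : (1 : Matrix (Fin p) (Fin p) ℝ) + t • B
        = U * diagonal (fun i => 1 + t * hB.eigenvalues i) * star U := by
      have hd : diagonal (fun i => 1 + t * hB.eigenvalues i)
          = 1 + t • diagonal hB.eigenvalues := by
        ext i j
        by_cases h : i = j <;> simp [h, diagonal]
      rw [hd, mul_add, add_mul, mul_one, hU, Matrix.mul_smul, Matrix.smul_mul, ← hs']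
    rw [this, det_mul_right_comm, hU, one_mul, det_diagonal, Polynomial.eval_prod]
    simp only [eval_add, eval_one, eval_mul, eval_X, eval_C]
  rw [esymmMatrix, key, Finset.prod_one_add]
  rw [Polynomial.finsetSum_coeff, Finset.powersetCard_eq_filter, Finset.sum_filter]
  refine Finset.sum_congr rfl fun s _ => ?_
  rw [Finset.prod_mul_distrib, Finset.prod_const, ← map_prod, mul_comm, coeff_C_mul_X_pow]
  simp [eq_comm]

/-- The conic combination `g_w = ∑_{q=0}^p w_q s_q`. -/
def conicSymm {p : ℕ} (w : Fin (p + 1) → ℝ) (B : Matrix (Fin p) (Fin p) ℝ) : ℝ :=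
  ∑ q : Fin (p + 1), w q * esymmMatrix (q : ℕ) B

/-- The objective `f_{g_w}(X) = g_w(Xᵀ Aᵀ A X) / g_w(Xᵀ X)`. -/
def conicObjective {m n p : ℕ} (A : Matrix (Fin m) (Fin n) ℝ) (w : Fin (p + 1) → ℝ)
    (X : Matrix (Fin n) (Fin p) ℝ) : ℝ :=
  conicSymm w (Xᵀ * Aᵀ * A * X) / conicSymm w (Xᵀ * X)

/-- The Stiefel manifold `St(n, p)` of `n × p` matrices with orthonormal columns. -/
def stiefel (n p : ℕ) : Set (Matrix (Fin n) (Fin p) ℝ) :=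
  {X | Xᵀ * X = 1}

/-- `Vp` is a `p`-leading right singular factor of `A`: it consists of the first `p` columns of `V`
in some singular value decomposition `A = U Σ Vᵀ` with orthogonal `U`, `V` and with nonnegative
singular values `σ 0 ≥ σ 1 ≥ …` on the diagonal of the `m × n` matrix `Σ`
(the values `σ k` with `k ≥ min m n` play no role). -/
def IsLeadingRightSingularFactor {m n p : ℕ} (hpn : p ≤ n) (A : Matrix (Fin m) (Fin n) ℝ)
    (Vp : Matrix (Fin n) (Fin p) ℝ) : Prop :=
  ∃ (U : Matrix (Fin m) (Fin m) ℝ) (V : Matrix (Fin n) (Fin n) ℝ) (σ : ℕ → ℝ),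
    U ∈ Matrix.orthogonalGroup (Fin m) ℝ ∧ V ∈ Matrix.orthogonalGroup (Fin n) ℝ ∧
    (∀ k, 0 ≤ σ k) ∧ Antitone σ ∧
    A = U * (Matrix.of fun (i : Fin m) (j : Fin n) => if (i : ℕ) = (j : ℕ) then σ i else 0) * Vᵀ ∧
    Vp = V.submatrix id (Fin.castLE hpn)

/-- The Lagrangian `f(X) + ⟨Xᵀ X - I, Λ⟩` of the program of optimising `f` over the Stiefel
manifold. -/
def stiefelLagrangian {n p : ℕ} (f : Matrix (Fin n) (Fin p) ℝ → ℝ) (Λ : Matrix (Fin p) (Fin p) ℝ)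
    (X : Matrix (Fin n) (Fin p) ℝ) : ℝ :=
  f X + trace ((Xᵀ * X - 1)ᵀ * Λ)

/-- `Λ` is a Lagrange multiplier at `X`: all first derivatives of the Lagrangian vanish at `X`,
i.e. `∇f(X) + X (Λ + Λᵀ) = 0`. (Only the symmetric part of `Λ` enters the Lagrangian, and that part
is determined by `X` when `X ∈ St(n, p)`.) -/
def IsStiefelMultiplier {n p : ℕ} (f : Matrix (Fin n) (Fin p) ℝ → ℝ)
    (X : Matrix (Fin n) (Fin p) ℝ) (Λ : Matrix (Fin p) (Fin p) ℝ) : Prop :=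
  ∀ Δ : Matrix (Fin n) (Fin p) ℝ, lineDeriv ℝ (stiefelLagrangian f Λ) X Δ = 0

/-- `X` is a stationary point of the program of optimising `f` over `St(n, p)`. -/
def IsStiefelStationary {n p : ℕ} (f : Matrix (Fin n) (Fin p) ℝ → ℝ)
    (X : Matrix (Fin n) (Fin p) ℝ) : Prop :=
  X ∈ stiefel n p ∧ ∃ Λ : Matrix (Fin p) (Fin p) ℝ, IsStiefelMultiplier f X Λ

/-- The Hessian form of the Lagrangian at `X`, evaluated at `[Δ, Δ]`:
`∇²f(X)[Δ, Δ] + 2 ⟨Δᵀ Δ, Λ⟩`. -/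
def stiefelHessian {n p : ℕ} (f : Matrix (Fin n) (Fin p) ℝ → ℝ) (Λ : Matrix (Fin p) (Fin p) ℝ)
    (X Δ : Matrix (Fin n) (Fin p) ℝ) : ℝ :=
  iteratedDeriv 2 (fun t : ℝ => stiefelLagrangian f Λ (X + t • Δ)) 0

/-- `X` has a (second-order) ascent direction: a tangent vector `Δ` to `St(n, p)` at `X` along which
the Hessian of the Lagrangian is positive. -/
def HasAscentDirection {n p : ℕ} (f : Matrix (Fin n) (Fin p) ℝ → ℝ)
    (X : Matrix (Fin n) (Fin p) ℝ) : Prop :=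
  ∃ Λ Δ, IsStiefelMultiplier f X Λ ∧ Xᵀ * Δ + Δᵀ * X = 0 ∧ 0 < stiefelHessian f Λ X Δ

/-- `X` has a (second-order) descent direction. -/
def HasDescentDirection {n p : ℕ} (f : Matrix (Fin n) (Fin p) ℝ → ℝ)
    (X : Matrix (Fin n) (Fin p) ℝ) : Prop :=
  ∃ Λ Δ, IsStiefelMultiplier f X Λ ∧ Xᵀ * Δ + Δᵀ * X = 0 ∧ stiefelHessian f Λ X Δ < 0

/-- A strict saddle point of the program of maximising `f` over `St(n, p)`: a stationary point with
an ascent direction which is a local minimiser or also has a descent direction. (As usual in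
the strict saddle property, stationary points that a maximisation method has to escape from, local
minimisers included, are counted.) -/
def IsStrictSaddle {n p : ℕ} (f : Matrix (Fin n) (Fin p) ℝ → ℝ)
    (X : Matrix (Fin n) (Fin p) ℝ) : Prop :=
  IsStiefelStationary f X ∧ HasAscentDirection f X ∧
    (IsLocalMinOn f (stiefel n p) X ∨ HasDescentDirection f X)

end

/-!
Write `B = Aᵀ A` and `N(X) = g_w(Xᵀ B X)`. On the Stiefel manifold the objective is `N(X)` divided
by the positive constant `g_w(1)`, and all optimality conditions are tested on variations of one
column.

*Variations.* Choose an orthogonal `Q` such that the frame `Z = X Q` makes `Zᵀ B Z = diagonal μ`,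
and let `y` be a unit vector orthogonal to the range of `X`. Replacing the column `z_j` by another
vector turns `Zᵀ B Z` into an arrowhead matrix (`det_arrowhead`), so `N` depends on the new column
through an inhomogeneous quadratic form (`conicSymm_updateCol`). Along the rotation `z_j ↦ cos t •
z_j + sin t • y` this gives `N = cos² t · N(Z) + sin² t · N(Z') + 2 sin t cos t · G_j ⟨z_j, B y⟩`,
where `Z'` is `Z` with `z_j` replaced by `y`, and where `G_j ≥ 0` (`conicSlope`) is the derivative
of `g_w (diagonal μ)` in `μ j`. Hence `G_j ⟨z_j, B y⟩ = 0` at stationary points and at local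
maximisers, and the Hessian of the Lagrangian in this direction is `2 (N(Z') - N(Z)) / g_w(1)`
(`stiefelMultiplier_columnVariation`).

*Above the level `w 0`.* One has `N ≥ w 0` everywhere. If `N(X) ≠ w 0`, then all
`G_j` are positive, stationarity makes the range of `X` invariant under `B`
(`ColumnStationary.invariant`), and for an eigenvector `y` with eigenvalue `ν` one has `N(Z') -
N(Z) = (ν - μ j) G_j`. So, unless the range of `X` belongs to the largest (smallest) eigenvalues
of `B`, there is an ascent (descent) direction.

*Global optimality.* A maximiser exists by compactness, and it is a frame of the former kind
(`IsDominant`). As the ordered eigenvalues of `B` are unique, all such frames give the same value,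
so all of them are global maximisers (`IsDominant.isMaxOn`); they are exactly the frames with the
range of a leading right singular factor. The analogous statement for minimisers is applied to `B
+ ε` and then `ε → 0` (`IsDominant.isMinOn`).

*On the level `w 0`.* Here `X` is a global minimiser and `q > rank (A X)` for every `q ≥ 1` with
`w q ≠ 0`. Some column of a frame is annihilated by `A` and can be turned so as to increase the
rank (`exists_rank_lt_updateCol`). Repeating this arbitrarily close to `X` shows that `X` is not a
local maximiser, and under the rank condition of the theorem a single replacement gives an ascent
direction.
-/

noncomputable section

/-! ### The polynomial `det (1 + t M)` and its coefficients -/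

/-- The polynomial `det (1 + t M)` in `t`, whose coefficients are the numbers `s_q(M)`. -/
def detOneAdd {p : ℕ} (M : Matrix (Fin p) (Fin p) ℝ) : ℝ[X] :=
  det (1 + (X : ℝ[X]) • M.map C)

/-- The linear functional `P ↦ ∑ q, w q * P.coeff q` on polynomials. It carries `det (1 + t M)` to
`g_w(M)`, so that identities for `g_w` follow from polynomial identities. -/
def coeffFunctional {p : ℕ} (w : Fin (p + 1) → ℝ) : ℝ[X] →ₗ[ℝ] ℝ :=
  ∑ q : Fin (p + 1), w q • lcoeff ℝ (q : ℕ)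

theorem coeffFunctional_apply {p : ℕ} (w : Fin (p + 1) → ℝ) (P : ℝ[X]) :
    coeffFunctional w P = ∑ q : Fin (p + 1), w q * P.coeff q := by
  simp [coeffFunctional]

theorem conicSymm_eq_coeffFunctional {p : ℕ} (w : Fin (p + 1) → ℝ)
    (M : Matrix (Fin p) (Fin p) ℝ) : conicSymm w M = coeffFunctional w (detOneAdd M) := by
  simp [coeffFunctional_apply, conicSymm, esymmMatrix, detOneAdd]

theorem eval_detOneAdd {p : ℕ} (M : Matrix (Fin p) (Fin p) ℝ) (t : ℝ) :
    (detOneAdd M).eval t = det (1 + t • M) := by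
  rw [detOneAdd, ← Polynomial.coe_evalRingHom, RingHom.map_det]
  congr 1
  ext i j
  simp [Matrix.one_apply]
  split_ifs <;> simp [mul_comm]

theorem detOneAdd_diagonal {p : ℕ} (μ : Fin p → ℝ) :
    detOneAdd (diagonal μ) = ∏ k, (1 + C (μ k) * X) := by
  apply Polynomial.funext
  intro t
  have : (1 : Matrix (Fin p) (Fin p) ℝ) + t • diagonal μ = diagonal fun k => 1 + μ k * t := by
    ext i j
    by_cases h : i = j <;> simp [h, diagonal, mul_comm]
  rw [eval_detOneAdd, this, det_diagonal, Polynomial.eval_prod]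
  simp

theorem detOneAdd_conj {p : ℕ} (M : Matrix (Fin p) (Fin p) ℝ) {Q : Matrix (Fin p) (Fin p) ℝ}
    (hQ : Qᵀ * Q = 1) : detOneAdd (Qᵀ * M * Q) = detOneAdd M := by
  apply Polynomial.funext
  intro t
  rw [eval_detOneAdd, eval_detOneAdd]
  have : (1 : Matrix (Fin p) (Fin p) ℝ) + t • (Qᵀ * M * Q) = Qᵀ * (1 + t • M) * Q := by
    rw [Matrix.mul_add, Matrix.add_mul, Matrix.mul_one, hQ, Matrix.mul_smul, Matrix.smul_mul]
  rw [this, det_mul_right_comm, hQ, Matrix.one_mul]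

theorem conicSymm_conj {p : ℕ} (w : Fin (p + 1) → ℝ) (M : Matrix (Fin p) (Fin p) ℝ)
    {Q : Matrix (Fin p) (Fin p) ℝ} (hQ : Qᵀ * Q = 1) :
    conicSymm w (Qᵀ * M * Q) = conicSymm w M := by
  rw [conicSymm_eq_coeffFunctional, conicSymm_eq_coeffFunctional, detOneAdd_conj M hQ]

theorem coeff_prod_one_add {ι : Type*} (s : Finset ι) (μ : ι → ℝ) (q : ℕ) :
    (∏ k ∈ s, (1 + C (μ k) * X)).coeff q = ∑ t ∈ s.powersetCard q, ∏ k ∈ t, μ k := by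
  rw [Finset.prod_one_add, Polynomial.finsetSum_coeff, Finset.powersetCard_eq_filter,
    Finset.sum_filter]
  refine Finset.sum_congr rfl fun t _ => ?_
  rw [Finset.prod_mul_distrib, Finset.prod_const, ← map_prod, coeff_C_mul_X_pow]
  simp [eq_comm]

theorem coeff_prod_one_add_nonneg {ι : Type*} (s : Finset ι) {μ : ι → ℝ} (hμ : ∀ k, 0 ≤ μ k)
    (q : ℕ) : 0 ≤ (∏ k ∈ s, (1 + C (μ k) * X)).coeff q := by
  rw [coeff_prod_one_add]
  exact Finset.sum_nonneg fun t _ => Finset.prod_nonneg fun k _ => hμ k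

theorem coeff_prod_one_add_pos {ι : Type*} (s : Finset ι) {μ : ι → ℝ} (hμ : ∀ k, 0 ≤ μ k)
    {q : ℕ} (hq : q ≤ (s.filter fun k => μ k ≠ 0).card) :
    0 < (∏ k ∈ s, (1 + C (μ k) * X)).coeff q := by
  rw [coeff_prod_one_add]
  obtain ⟨t, ht, rfl⟩ := Finset.exists_subset_card_eq hq
  refine Finset.sum_pos' (fun t _ => Finset.prod_nonneg fun k _ => hμ k) ⟨t, ?_, ?_⟩
  · exact Finset.mem_powersetCard.2 ⟨ht.trans (Finset.filter_subset _ _), rfl⟩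
  · exact Finset.prod_pos fun k hk => lt_of_le_of_ne (hμ k) (Finset.mem_filter.1 (ht hk)).2.symm

theorem coeff_prod_one_add_eq_zero {ι : Type*} (s : Finset ι) {μ : ι → ℝ}
    {q : ℕ} (hq : (s.filter fun k => μ k ≠ 0).card < q) :
    (∏ k ∈ s, (1 + C (μ k) * X)).coeff q = 0 := by
  rw [coeff_prod_one_add]
  refine Finset.sum_eq_zero fun t ht => ?_
  obtain ⟨hts, htq⟩ := Finset.mem_powersetCard.1 ht
  by_contra h
  have : t ⊆ s.filter fun k => μ k ≠ 0 := fun k hk =>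
    Finset.mem_filter.2 ⟨hts hk, Finset.prod_ne_zero_iff.1 h k hk⟩
  have := Finset.card_le_card this
  omega

/-! ### Orthogonal diagonalisation and the values of `g_w` on positive semidefinite matrices -/

/-- A real symmetric matrix has an orthogonal diagonalisation with nonincreasing eigenvalues. -/
theorem exists_orthogonal_diagonalisation {p : ℕ} {M : Matrix (Fin p) (Fin p) ℝ} (hM : Mᵀ = M) :
    ∃ (Q : Matrix (Fin p) (Fin p) ℝ) (μ : Fin p → ℝ),
      Qᵀ * Q = 1 ∧ Antitone μ ∧ Qᵀ * M * Q = diagonal μ := by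
  have hH : M.IsHermitian := by rw [IsHermitian, conjTranspose_eq_transpose_of_trivial, hM]
  set U : Matrix (Fin p) (Fin p) ℝ := (hH.eigenvectorUnitary : Matrix (Fin p) (Fin p) ℝ)
  have hU : Uᵀ * U = 1 := by
    have := Matrix.mem_unitaryGroup_iff'.mp hH.eigenvectorUnitary.2
    rwa [star_eq_conjTranspose, conjTranspose_eq_transpose_of_trivial] at this
  have hs : M = U * diagonal hH.eigenvalues * Uᵀ := by
    have := hH.spectral_theorem
    simpa [Unitary.conjStarAlgAut_apply, Function.comp_def, star_eq_conjTranspose] using this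
  have hd : Uᵀ * M * U = diagonal hH.eigenvalues := by
    conv_lhs => rw [hs]
    rw [show Uᵀ * (U * diagonal hH.eigenvalues * Uᵀ) * U
      = (Uᵀ * U) * diagonal hH.eigenvalues * (Uᵀ * U) by simp only [Matrix.mul_assoc], hU]
    simp
  let e : Equiv.Perm (Fin p) := Tuple.sort (fun i => -hH.eigenvalues i)
  have he : Monotone ((fun i => -hH.eigenvalues i) ∘ e) := Tuple.monotone_sort _
  refine ⟨U.submatrix id e, hH.eigenvalues ∘ e, ?_, ?_, ?_⟩
  · have : (U.submatrix id e)ᵀ * U.submatrix id e = (Uᵀ * U).submatrix e e := by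
      ext i j; simp [mul_apply]
    rw [this, hU]
    simp
  · intro i j hij
    have := he hij
    simp only [Function.comp] at this ⊢
    linarith
  · have : (U.submatrix id e)ᵀ * M * U.submatrix id e = (Uᵀ * M * U).submatrix e e := by
      ext i j; simp [mul_apply]
    rw [this, hd]
    simp [submatrix_diagonal_equiv]

theorem conicSymm_diagonal {p : ℕ} (w : Fin (p + 1) → ℝ) (μ : Fin p → ℝ) :
    conicSymm w (diagonal μ) = ∑ q, w q * (∏ k, (1 + C (μ k) * X)).coeff (q : ℕ) := by
  rw [conicSymm_eq_coeffFunctional, detOneAdd_diagonal, coeffFunctional_apply]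

theorem Matrix.PosSemidef.transpose_eq {k : ℕ} {M : Matrix (Fin k) (Fin k) ℝ}
    (hM : M.PosSemidef) : Mᵀ = M := by
  have := hM.1
  rwa [IsHermitian, conjTranspose_eq_transpose_of_trivial] at this

/-- A positive semidefinite matrix has an orthogonal diagonalisation in which the rank counts the
nonzero eigenvalues. -/
theorem Matrix.PosSemidef.exists_diagonalisation {p : ℕ} {M : Matrix (Fin p) (Fin p) ℝ}
    (hM : M.PosSemidef) : ∃ (Q : Matrix (Fin p) (Fin p) ℝ) (μ : Fin p → ℝ),
      Qᵀ * Q = 1 ∧ Qᵀ * M * Q = diagonal μ ∧ (∀ k, 0 ≤ μ k) ∧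
      M.rank = (Finset.univ.filter fun k => μ k ≠ 0).card := by
  obtain ⟨Q, μ, hQ, -, hd⟩ := exists_orthogonal_diagonalisation hM.transpose_eq
  refine ⟨Q, μ, hQ, hd, fun k => ?_, ?_⟩
  · have h := (hM.conjTranspose_mul_mul_same Q).diag_nonneg (i := k)
    rw [conjTranspose_eq_transpose_of_trivial, hd, diagonal_apply_eq] at h
    exact h
  · have hu : IsUnit Q.det := Matrix.isUnit_det_of_left_inverse hQ
    have hu' : IsUnit Qᵀ.det := by rwa [det_transpose]
    have : (diagonal μ).rank = M.rank := by
      rw [← hd, rank_mul_eq_left_of_isUnit_det _ _ hu, rank_mul_eq_right_of_isUnit_det _ _ hu']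
    rw [← this, rank_diagonal, Fintype.card_subtype]

section PosSemidef

variable {p : ℕ} {w : Fin (p + 1) → ℝ} {M : Matrix (Fin p) (Fin p) ℝ}

theorem conicSymm_eq_diagonal (w : Fin (p + 1) → ℝ) {Q : Matrix (Fin p) (Fin p) ℝ} {μ : Fin p → ℝ}
    (hQ : Qᵀ * Q = 1) (hd : Qᵀ * M * Q = diagonal μ) :
    conicSymm w M = ∑ q, w q * (∏ k, (1 + C (μ k) * X)).coeff (q : ℕ) := by
  rw [← conicSymm_conj w M hQ, hd, conicSymm_diagonal]

theorem weight_zero_mul_coeff (w : Fin (p + 1) → ℝ) (μ : Fin p → ℝ) :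
    w 0 * (∏ k, (1 + C (μ k) * X)).coeff ((0 : Fin (p + 1)) : ℕ) = w 0 := by
  simp [coeff_prod_one_add]

/-- `s_0 = 1` and all `s_q` are nonnegative on positive semidefinite matrices. -/
theorem weight_zero_le_conicSymm (hw : ∀ q, 0 ≤ w q) (hM : M.PosSemidef) :
    w 0 ≤ conicSymm w M := by
  obtain ⟨Q, μ, hQ, hd, hμ, -⟩ := hM.exists_diagonalisation
  rw [conicSymm_eq_diagonal w hQ hd]
  refine (weight_zero_mul_coeff w μ).symm.le.trans ?_
  exact Finset.single_le_sum (f := fun q : Fin (p + 1) => w q * (∏ k, (1 + C (μ k) * X)).coeff q)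
    (fun q _ => mul_nonneg (hw q) (coeff_prod_one_add_nonneg _ hμ _)) (Finset.mem_univ 0)

/-- `s_q(M) > 0` when `q ≤ rank M`. -/
theorem weight_zero_lt_conicSymm (hw : ∀ q, 0 ≤ w q) (hM : M.PosSemidef) {q : Fin (p + 1)}
    (hq : 1 ≤ (q : ℕ)) (hwq : w q ≠ 0) (hr : (q : ℕ) ≤ M.rank) : w 0 < conicSymm w M := by
  obtain ⟨Q, μ, hQ, hd, hμ, hrank⟩ := hM.exists_diagonalisation
  rw [conicSymm_eq_diagonal w hQ hd]
  have hq0 : (0 : Fin (p + 1)) ≠ q := by rintro rfl; simp at hq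
  refine (weight_zero_mul_coeff w μ).symm.le.trans_lt ?_
  refine Finset.single_lt_sum
    (f := fun q : Fin (p + 1) => w q * (∏ k, (1 + C (μ k) * X)).coeff q) hq0.symm
    (Finset.mem_univ 0) (Finset.mem_univ q) ?_
    (fun q _ _ => mul_nonneg (hw q) (coeff_prod_one_add_nonneg _ hμ _))
  exact mul_pos (lt_of_le_of_ne (hw q) hwq.symm) (coeff_prod_one_add_pos _ hμ (hrank ▸ hr))

/-- `s_q(M) = 0` when `q > rank M`. -/
theorem conicSymm_eq_weight_zero (hM : M.PosSemidef)
    (h : ∀ q : Fin (p + 1), 1 ≤ (q : ℕ) → w q ≠ 0 → M.rank < q) : conicSymm w M = w 0 := by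
  obtain ⟨Q, μ, hQ, hd, hμ, hrank⟩ := hM.exists_diagonalisation
  rw [conicSymm_eq_diagonal w hQ hd, Finset.sum_eq_single 0, weight_zero_mul_coeff]
  · intro q _ hq0
    by_cases hwq : w q = 0
    · simp [hwq]
    rw [coeff_prod_one_add_eq_zero, mul_zero]
    rw [← hrank]
    refine h q ?_ hwq
    exact Nat.one_le_iff_ne_zero.2 fun h0 => hq0 (Fin.ext h0)
  · simp

theorem exists_le_rank_of_weight_zero_ne (hM : M.PosSemidef) (h : conicSymm w M ≠ w 0) :
    ∃ q : Fin (p + 1), 1 ≤ (q : ℕ) ∧ w q ≠ 0 ∧ (q : ℕ) ≤ M.rank := by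
  by_contra! hc
  exact h (conicSymm_eq_weight_zero hM hc)

end PosSemidef

/-! ### Replacing one column in a diagonalising frame -/

/-- The determinant of a symmetric arrowhead matrix: off the diagonal only the `j`-th row and the
`j`-th column are nonzero. -/
theorem det_arrowhead {p : ℕ} (M : Matrix (Fin p) (Fin p) ℝ) (j : Fin p)
    (hsym : ∀ k, k ≠ j → M j k = M k j) (hoff : ∀ k l, k ≠ j → l ≠ j → k ≠ l → M k l = 0)
    (hne : ∀ k, k ≠ j → M k k ≠ 0) :
    det M = M j j * ∏ k ∈ Finset.univ.erase j, M k k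
      - ∑ k ∈ Finset.univ.erase j, M k j ^ 2 * ∏ l ∈ (Finset.univ.erase j).erase k, M l l := by
  -- `M = L D Lᵀ` with `D` diagonal and `L` unit triangular up to reordering
  set c : Fin p → ℝ := fun k => if k = j then 0 else M k j / M k k with hc
  set d : Fin p → ℝ := fun k =>
    if k = j then M j j - ∑ k ∈ Finset.univ.erase j, M k j ^ 2 / M k k else M k k with hd
  set L : Matrix (Fin p) (Fin p) ℝ := 1 + vecMulVec (Pi.single j 1) c with hL
  have hLj : ∀ k, k ≠ j → L j k = M k j / M k k := by
    intro k hk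
    simp [hL, hc, vecMulVec_apply, one_apply, hk, hk.symm]
  have hLjj : L j j = 1 := by simp [hL, hc, vecMulVec_apply]
  have hLa : ∀ a k, a ≠ j → L a k = if a = k then 1 else 0 := by
    intro a k ha
    simp [hL, vecMulVec_apply, one_apply, ha]
  have hfac : M = L * diagonal d * Lᵀ := by
    ext a b
    have hab : (L * diagonal d * Lᵀ) a b = ∑ k, L a k * d k * L b k := by
      rw [mul_apply]
      exact Finset.sum_congr rfl fun k _ => by rw [mul_diagonal, transpose_apply]
    rw [hab]
    by_cases ha : a = j
    · by_cases hb : b = j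
      · subst ha; subst hb
        rw [← Finset.add_sum_erase _ _ (Finset.mem_univ b), hLjj]
        have : ∀ k ∈ Finset.univ.erase b, L b k * d k * L b k = M k b ^ 2 / M k k := by
          intro k hk
          have hk := (Finset.mem_erase.1 hk).1
          have := hne k hk
          rw [hLj k hk, hd]
          simp only [hk, if_false]
          field_simp
        rw [Finset.sum_congr rfl this]
        simp [hd]
      · subst ha
        simp only [hLa b _ hb, mul_ite, mul_one, mul_zero, Finset.sum_ite_eq, Finset.mem_univ,
          if_true]
        rw [hLj b hb, hsym b hb, hd]
        simp only [hb, if_false]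
        rw [div_mul_cancel₀ _ (hne b hb)]
    · simp only [hLa a _ ha, ite_mul, one_mul, zero_mul, Finset.sum_ite_eq, Finset.mem_univ,
        if_true]
      by_cases hb : b = j
      · subst hb
        rw [hLj a ha, hd]
        simp only [ha, if_false]
        rw [mul_div_cancel₀ _ (hne a ha)]
      · rw [hLa b a hb]
        by_cases hba : b = a
        · subst hba; simp [hd, hb]
        · simp [hba, hoff a b ha hb (Ne.symm hba)]
  have hdetL : L.det = 1 := by
    rw [hL, vecMulVec_eq Unit, det_one_add_replicateCol_mul_replicateRow]
    simp [hc]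
  have hdet : M.det = ∏ k, d k := by
    conv_lhs => rw [hfac]
    rw [det_mul, det_mul, det_transpose, hdetL, det_diagonal]
    ring
  rw [hdet, ← Finset.mul_prod_erase _ _ (Finset.mem_univ j)]
  have h1 : ∏ k ∈ Finset.univ.erase j, d k = ∏ k ∈ Finset.univ.erase j, M k k :=
    Finset.prod_congr rfl fun k hk => by simp [hd, (Finset.mem_erase.1 hk).1]
  have h2 : d j = M j j - ∑ k ∈ Finset.univ.erase j, M k j ^ 2 / M k k := by simp [hd]
  rw [h1, h2, sub_mul, Finset.sum_mul]
  congr 1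
  refine Finset.sum_congr rfl fun k hk => ?_
  rw [← Finset.mul_prod_erase _ _ hk]
  have := hne k (Finset.mem_erase.1 hk).1
  field_simp

/-- The polynomial `∏_{k ≠ j} (1 + μ_k t)`. -/
def prodOneAddErase {p : ℕ} (μ : Fin p → ℝ) (j : Fin p) : ℝ[X] :=
  ∏ k ∈ Finset.univ.erase j, (1 + C (μ k) * X)

/-- The partial derivative of `g_w (diagonal μ)` with respect to `μ j`, that is
`∑ q, w_q s_{q-1}(μ without μ_j)`. -/
def conicSlope {p : ℕ} (w : Fin (p + 1) → ℝ) (μ : Fin p → ℝ) (j : Fin p) : ℝ :=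
  coeffFunctional w (X * prodOneAddErase μ j)

/-- The part of `g_w (diagonal μ)` that does not depend on `μ j`. -/
def conicRest {p : ℕ} (w : Fin (p + 1) → ℝ) (μ : Fin p → ℝ) (j : Fin p) : ℝ :=
  coeffFunctional w (prodOneAddErase μ j)

theorem conicSlope_nonneg {p : ℕ} {w : Fin (p + 1) → ℝ} (hw : ∀ q, 0 ≤ w q) {μ : Fin p → ℝ}
    (hμ : ∀ k, 0 ≤ μ k) (j : Fin p) : 0 ≤ conicSlope w μ j := by
  rw [conicSlope, coeffFunctional_apply]
  refine Finset.sum_nonneg fun q _ => mul_nonneg (hw q) ?_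
  rcases Nat.eq_zero_or_pos (q : ℕ) with h | h
  · simp [h]
  · obtain ⟨r, hr⟩ := Nat.exists_eq_add_of_le' h
    rw [hr, coeff_X_mul]
    exact coeff_prod_one_add_nonneg _ hμ _

theorem conicSlope_pos {p : ℕ} {w : Fin (p + 1) → ℝ} (hw : ∀ q, 0 ≤ w q) {μ : Fin p → ℝ}
    (hμ : ∀ k, 0 ≤ μ k) (j : Fin p) {q : Fin (p + 1)} (hq : 1 ≤ (q : ℕ)) (hwq : w q ≠ 0)
    (hr : (q : ℕ) ≤ (Finset.univ.filter fun k => μ k ≠ 0).card) : 0 < conicSlope w μ j := by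
  rw [conicSlope, coeffFunctional_apply]
  refine Finset.sum_pos' (fun q _ => mul_nonneg (hw q) ?_)
    ⟨q, Finset.mem_univ q, mul_pos (lt_of_le_of_ne (hw q) hwq.symm) ?_⟩
  · rcases Nat.eq_zero_or_pos (q : ℕ) with h | h
    · simp [h]
    · obtain ⟨r, hr⟩ := Nat.exists_eq_add_of_le' h
      rw [hr, coeff_X_mul]
      exact coeff_prod_one_add_nonneg _ hμ _
  · obtain ⟨r, hr'⟩ := Nat.exists_eq_add_of_le' hq
    rw [hr', coeff_X_mul]
    refine coeff_prod_one_add_pos _ hμ ?_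
    have h1 : (Finset.univ.filter fun k => μ k ≠ 0).erase j
        ⊆ (Finset.univ.erase j).filter fun k => μ k ≠ 0 := by
      intro k hk
      simp at hk ⊢
      tauto
    have h2 := Finset.card_le_card h1
    have h3 := Finset.pred_card_le_card_erase (s := Finset.univ.filter fun k => μ k ≠ 0) (a := j)
    omega

section Replace

variable {n p : ℕ} {B : Matrix (Fin n) (Fin n) ℝ} {Z : Matrix (Fin n) (Fin p) ℝ} {μ : Fin p → ℝ}

theorem gram_apply (B : Matrix (Fin n) (Fin n) ℝ) (Z : Matrix (Fin n) (Fin p) ℝ) (k l : Fin p) :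
    (Zᵀ * B * Z) k l = Z.col k ⬝ᵥ B *ᵥ Z.col l := by
  rw [Matrix.mul_assoc]
  rfl

theorem dotProduct_mulVec_symm (hB : Bᵀ = B) (u v : Fin n → ℝ) :
    u ⬝ᵥ B *ᵥ v = v ⬝ᵥ B *ᵥ u := by
  rw [dotProduct_comm, ← vecMul_transpose, hB, dotProduct_mulVec]

theorem col_updateCol_self (Z : Matrix (Fin n) (Fin p) ℝ) (j : Fin p) (v : Fin n → ℝ) :
    (Z.updateCol j v).col j = v := by
  ext i; simp

theorem col_updateCol_ne (Z : Matrix (Fin n) (Fin p) ℝ) {j k : Fin p} (v : Fin n → ℝ)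
    (h : k ≠ j) : (Z.updateCol j v).col k = Z.col k := by
  ext i; simp [h]

/-- If `Zᵀ B Z` is diagonal, the Gram matrix after replacing one column of `Z` is an arrowhead
matrix, whence `g_w` is an inhomogeneous quadratic form in the new column. -/
theorem conicSymm_updateCol (w : Fin (p + 1) → ℝ) (hB : Bᵀ = B) (hZ : Zᵀ * B * Z = diagonal μ)
    (hμ : ∀ k, 0 ≤ μ k) (j : Fin p) (v : Fin n → ℝ) :
    conicSymm w ((Z.updateCol j v)ᵀ * B * Z.updateCol j v) =
      conicRest w μ j + (v ⬝ᵥ B *ᵥ v) * conicSlope w μ j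
      - ∑ k ∈ Finset.univ.erase j, (Z.col k ⬝ᵥ B *ᵥ v) ^ 2 *
          coeffFunctional w (X ^ 2 * ∏ l ∈ (Finset.univ.erase j).erase k, (1 + C (μ l) * X)) := by
  set Y := Z.updateCol j v with hY
  have hjj : (Yᵀ * B * Y) j j = v ⬝ᵥ B *ᵥ v := by
    rw [gram_apply, hY, col_updateCol_self]
  have hkj : ∀ k, k ≠ j → (Yᵀ * B * Y) k j = Z.col k ⬝ᵥ B *ᵥ v := by
    intro k hk
    rw [gram_apply, hY, col_updateCol_self, col_updateCol_ne _ _ hk]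
  have hjk : ∀ k, k ≠ j → (Yᵀ * B * Y) j k = Z.col k ⬝ᵥ B *ᵥ v := by
    intro k hk
    rw [gram_apply, hY, col_updateCol_self, col_updateCol_ne _ _ hk, dotProduct_mulVec_symm hB]
  have hkl : ∀ k l, k ≠ j → l ≠ j → (Yᵀ * B * Y) k l = if k = l then μ k else 0 := by
    intro k l hk hl
    rw [gram_apply, hY, col_updateCol_ne _ _ hk, col_updateCol_ne _ _ hl, ← gram_apply, hZ,
      diagonal_apply]
  have key : detOneAdd (Yᵀ * B * Y) = prodOneAddErase μ j
      + (v ⬝ᵥ B *ᵥ v) • (X * prodOneAddErase μ j)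
      - ∑ k ∈ Finset.univ.erase j, (Z.col k ⬝ᵥ B *ᵥ v) ^ 2 •
          (X ^ 2 * ∏ l ∈ (Finset.univ.erase j).erase k, (1 + C (μ l) * X)) := by
    -- both sides agree at every `t > 0`, where the entries `1 + t μ_k` are invertible
    refine Polynomial.eq_of_infinite_eval_eq _ _ ((Set.Ioi_infinite (0 : ℝ)).mono ?_)
    intro t ht
    have ht : 0 < t := ht
    rw [Set.mem_ofPred_eq, eval_detOneAdd]
    set T : Matrix (Fin p) (Fin p) ℝ := 1 + t • (Yᵀ * B * Y) with hT
    have hTa : ∀ k l, T k l = (1 : Matrix (Fin p) (Fin p) ℝ) k l + t * (Yᵀ * B * Y) k l :=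
      fun _ _ => rfl
    have hTkk : ∀ k, k ≠ j → T k k = 1 + μ k * t := by
      intro k hk
      rw [hTa, hkl k k hk hk, if_pos rfl, one_apply_eq, mul_comm]
    rw [det_arrowhead T j]
    · have h1 : ∏ k ∈ Finset.univ.erase j, T k k = ∏ k ∈ Finset.univ.erase j, (1 + μ k * t) :=
        Finset.prod_congr rfl fun k hk => hTkk k (Finset.mem_erase.1 hk).1
      have h2 : ∀ k ∈ Finset.univ.erase j,
          T k j ^ 2 * ∏ l ∈ (Finset.univ.erase j).erase k, T l l
          = (Z.col k ⬝ᵥ B *ᵥ v) ^ 2 *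
            (t ^ 2 * ∏ l ∈ (Finset.univ.erase j).erase k, (1 + μ l * t)) := by
        intro k hk
        have hk' := (Finset.mem_erase.1 hk).1
        rw [Finset.prod_congr rfl fun l hl =>
          hTkk l (Finset.mem_erase.1 (Finset.mem_of_mem_erase hl)).1]
        rw [hTa, hkj k hk', one_apply_ne hk']
        ring
      rw [h1, Finset.sum_congr rfl h2, hTa, hjj, one_apply_eq]
      simp only [prodOneAddErase, eval_sub, eval_add, eval_smul, eval_mul, eval_X, eval_prod,
        eval_finsetSum, eval_one, eval_C, eval_pow, smul_eq_mul]
      ring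
    · intro k hk
      rw [hTa, hTa, hkj k hk, hjk k hk, one_apply_ne hk, one_apply_ne hk.symm]
    · intro k l hk hl hne
      rw [hTa, hkl k l hk hl, one_apply_ne hne, if_neg hne]
      ring
    · intro k hk
      rw [hTkk k hk]
      have := mul_nonneg (hμ k) ht.le
      positivity
  rw [conicSymm_eq_coeffFunctional, key, map_sub, map_add, map_smul, map_sum]
  simp only [map_smul, smul_eq_mul]
  rfl

theorem conicSymm_eq_rest_add (w : Fin (p + 1) → ℝ) (hB : Bᵀ = B) (hZ : Zᵀ * B * Z = diagonal μ)
    (hμ : ∀ k, 0 ≤ μ k) (j : Fin p) :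
    conicSymm w (Zᵀ * B * Z) = conicRest w μ j + μ j * conicSlope w μ j := by
  have h := conicSymm_updateCol w hB hZ hμ j (Z.col j)
  have hself : Z.updateCol j (Z.col j) = Z := updateCol_eq_self _ _
  rw [hself, ← gram_apply, hZ, diagonal_apply_eq, Finset.sum_eq_zero, sub_zero] at h
  · rw [hZ]; exact h
  · intro k hk
    rw [← gram_apply, hZ, diagonal_apply_ne _ (Finset.mem_erase.1 hk).1]
    ring

/-- The dependence of `g_w` on the two coefficients of the new column `a z_j + b y`. -/
theorem conicSymm_updateCol_combination (w : Fin (p + 1) → ℝ) (hB : Bᵀ = B)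
    (hZ : Zᵀ * B * Z = diagonal μ) (hμ : ∀ k, 0 ≤ μ k) (j : Fin p) (y : Fin n → ℝ) (a b : ℝ) :
    conicSymm w ((Z.updateCol j (a • Z.col j + b • y))ᵀ * B *
        Z.updateCol j (a • Z.col j + b • y)) =
      conicRest w μ j
      + a ^ 2 * (conicSymm w (Zᵀ * B * Z) - conicRest w μ j)
      + b ^ 2 * (conicSymm w ((Z.updateCol j y)ᵀ * B * Z.updateCol j y) - conicRest w μ j)
      + 2 * a * b * (conicSlope w μ j * (Z.col j ⬝ᵥ B *ᵥ y)) := by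
  rw [conicSymm_updateCol w hB hZ hμ, conicSymm_updateCol w hB hZ hμ,
    conicSymm_eq_rest_add w hB hZ hμ j]
  have h1 : (a • Z.col j + b • y) ⬝ᵥ B *ᵥ (a • Z.col j + b • y)
      = a ^ 2 * μ j + 2 * a * b * (Z.col j ⬝ᵥ B *ᵥ y) + b ^ 2 * (y ⬝ᵥ B *ᵥ y) := by
    have h2 : Z.col j ⬝ᵥ B *ᵥ Z.col j = μ j := by rw [← gram_apply, hZ, diagonal_apply_eq]
    simp only [mulVec_add, mulVec_smul, dotProduct_add, add_dotProduct, smul_dotProduct,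
      dotProduct_smul, smul_eq_mul, h2, dotProduct_mulVec_symm hB y (Z.col j)]
    ring
  have h3 : ∀ k ∈ Finset.univ.erase j, (Z.col k ⬝ᵥ B *ᵥ (a • Z.col j + b • y)) ^ 2 *
          coeffFunctional w (X ^ 2 * ∏ l ∈ (Finset.univ.erase j).erase k, (1 + C (μ l) * X))
      = b ^ 2 * ((Z.col k ⬝ᵥ B *ᵥ y) ^ 2 *
          coeffFunctional w
            (X ^ 2 * ∏ l ∈ (Finset.univ.erase j).erase k, (1 + C (μ l) * X))) := by
    intro k hk
    have h4 : Z.col k ⬝ᵥ B *ᵥ Z.col j = 0 := by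
      rw [← gram_apply, hZ, diagonal_apply_ne _ (Finset.mem_erase.1 hk).1]
    simp only [mulVec_add, mulVec_smul, dotProduct_add, dotProduct_smul, smul_eq_mul, h4]
    ring
  rw [h1, Finset.sum_congr rfl h3, ← Finset.mul_sum]
  ring

/-- Replacing `z_j` by a unit eigenvector orthogonal to all columns changes `g_w` by the
difference of the eigenvalues times the slope. -/
theorem conicSymm_updateCol_eigenvector (w : Fin (p + 1) → ℝ) (hB : Bᵀ = B)
    (hZ : Zᵀ * B * Z = diagonal μ) (hμ : ∀ k, 0 ≤ μ k) (j : Fin p) {y : Fin n → ℝ} {ν : ℝ}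
    (hy : y ⬝ᵥ y = 1) (hZy : Zᵀ *ᵥ y = 0) (hν : B *ᵥ y = ν • y) :
    conicSymm w ((Z.updateCol j y)ᵀ * B * Z.updateCol j y) =
      conicSymm w (Zᵀ * B * Z) + (ν - μ j) * conicSlope w μ j := by
  rw [conicSymm_updateCol w hB hZ hμ, conicSymm_eq_rest_add w hB hZ hμ j, Finset.sum_eq_zero]
  · rw [hν, dotProduct_smul, hy, smul_eq_mul]
    ring
  · intro k _
    have : Z.col k ⬝ᵥ y = 0 := congrFun hZy k
    rw [hν, dotProduct_smul, this]
    simp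

end Replace

/-! ### Frames and the objective along one-column variations -/

section Stiefel

variable {n p : ℕ} {X Z : Matrix (Fin n) (Fin p) ℝ} {Q : Matrix (Fin p) (Fin p) ℝ}

theorem mul_mem_stiefel (hX : X ∈ stiefel n p) (hQ : Qᵀ * Q = 1) : X * Q ∈ stiefel n p := by
  have hX : Xᵀ * X = 1 := hX
  rw [stiefel, Set.mem_ofPred_eq, transpose_mul, Matrix.mul_assoc, ← Matrix.mul_assoc Xᵀ, hX,
    Matrix.one_mul, hQ]

theorem updateCol_mem_stiefel (hZ : Z ∈ stiefel n p) (j : Fin p) {v : Fin n → ℝ}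
    (hv : v ⬝ᵥ v = 1) (hZv : ∀ k, k ≠ j → Z.col k ⬝ᵥ v = 0) : Z.updateCol j v ∈ stiefel n p := by
  have hZ : Zᵀ * Z = 1 := hZ
  have hcol : ∀ k l, Z.col k ⬝ᵥ Z.col l = (1 : Matrix (Fin p) (Fin p) ℝ) k l := fun k l => by
    rw [← hZ]; rfl
  rw [stiefel, Set.mem_ofPred_eq]
  ext k l
  change (Z.updateCol j v).col k ⬝ᵥ (Z.updateCol j v).col l = _
  by_cases hk : k = j <;> by_cases hl : l = j
  · rw [hk, hl, col_updateCol_self, hv, one_apply_eq]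
  · rw [hk, col_updateCol_self, col_updateCol_ne _ _ hl, dotProduct_comm, hZv l hl,
      one_apply_ne (Ne.symm hl)]
  · rw [hl, col_updateCol_self, col_updateCol_ne _ _ hk, hZv k hk, one_apply_ne hk]
  · rw [col_updateCol_ne _ _ hk, col_updateCol_ne _ _ hl, hcol]

theorem updateCol_rotation_mem_stiefel (hZ : Z ∈ stiefel n p) (j : Fin p) {y : Fin n → ℝ}
    (hy : y ⬝ᵥ y = 1) (hZy : Zᵀ *ᵥ y = 0) (t : ℝ) :
    Z.updateCol j (Real.cos t • Z.col j + Real.sin t • y) ∈ stiefel n p := by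
  have hZ' : Zᵀ * Z = 1 := hZ
  have hcol : ∀ k l, Z.col k ⬝ᵥ Z.col l = (1 : Matrix (Fin p) (Fin p) ℝ) k l := fun k l => by
    rw [← hZ']; rfl
  have hy' : ∀ k, Z.col k ⬝ᵥ y = 0 := fun k => congrFun hZy k
  refine updateCol_mem_stiefel hZ j ?_ fun k hk => ?_
  · simp only [dotProduct_add, add_dotProduct, smul_dotProduct, dotProduct_smul, smul_eq_mul,
      hcol, hy, hy', dotProduct_comm y, one_apply_eq]
    linear_combination Real.cos_sq_add_sin_sq t
  · simp only [dotProduct_add, dotProduct_smul, smul_eq_mul, hcol, hy', one_apply_ne hk]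
    ring

theorem transpose_mul_mulVec_eq_zero {y : Fin n → ℝ} (h : Xᵀ *ᵥ y = 0)
    (Q : Matrix (Fin p) (Fin p) ℝ) :
    (X * Q)ᵀ *ᵥ y = 0 := by
  rw [transpose_mul, ← mulVec_mulVec, h, mulVec_zero]

theorem gram_mul (B : Matrix (Fin n) (Fin n) ℝ) (X : Matrix (Fin n) (Fin p) ℝ)
    (Q : Matrix (Fin p) (Fin p) ℝ) : (X * Q)ᵀ * B * (X * Q) = Qᵀ * (Xᵀ * B * X) * Q := by
  simp only [transpose_mul, Matrix.mul_assoc]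

theorem conicSymm_gram_mul (w : Fin (p + 1) → ℝ) (B : Matrix (Fin n) (Fin n) ℝ)
    (X : Matrix (Fin n) (Fin p) ℝ) (hQ : Qᵀ * Q = 1) :
    conicSymm w ((X * Q)ᵀ * B * (X * Q)) = conicSymm w (Xᵀ * B * X) := by
  rw [gram_mul, conicSymm_conj w _ hQ]

/-- The matrix whose `j`-th column in the frame `X Q` is `v`, all other columns being zero. -/
def columnVariation (Q : Matrix (Fin p) (Fin p) ℝ) (j : Fin p) (v : Fin n → ℝ) :
    Matrix (Fin n) (Fin p) ℝ :=
  vecMulVec v (Pi.single j 1) * Qᵀ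

theorem updateCol_eq_add (Z : Matrix (Fin n) (Fin p) ℝ) (j : Fin p) (v : Fin n → ℝ) :
    Z.updateCol j (Z.col j + v) = Z + vecMulVec v (Pi.single j 1) := by
  ext a b
  by_cases hb : b = j
  · subst hb; simp [vecMulVec_apply, Matrix.add_apply]
  · simp [vecMulVec_apply, Matrix.add_apply, hb]

theorem add_columnVariation_mul (hQ : Qᵀ * Q = 1) (X : Matrix (Fin n) (Fin p) ℝ) (j : Fin p)
    (v : Fin n → ℝ) (t : ℝ) : (X + t • columnVariation Q j v) * Q
      = (X * Q).updateCol j ((X * Q).col j + t • v) := by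
  rw [updateCol_eq_add, Matrix.add_mul, columnVariation, Matrix.smul_mul, Matrix.mul_assoc, hQ,
    Matrix.mul_one, smul_vecMulVec]

end Stiefel

section Objective

variable {m n p : ℕ} {A : Matrix (Fin m) (Fin n) ℝ} {w : Fin (p + 1) → ℝ}

theorem conicObjective_eq (A : Matrix (Fin m) (Fin n) ℝ) (w : Fin (p + 1) → ℝ)
    (X : Matrix (Fin n) (Fin p) ℝ) : conicObjective A w X =
      conicSymm w (Xᵀ * (Aᵀ * A) * X) / conicSymm w (Xᵀ * (1 : Matrix (Fin n) (Fin n) ℝ) * X) := by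
  rw [conicObjective, Matrix.mul_one]
  simp only [Matrix.mul_assoc]

theorem conicObjective_of_mem_stiefel {X : Matrix (Fin n) (Fin p) ℝ} (hX : X ∈ stiefel n p) :
    conicObjective A w X = conicSymm w (Xᵀ * (Aᵀ * A) * X) / conicSymm w 1 := by
  have hX : Xᵀ * X = 1 := hX
  rw [conicObjective_eq, Matrix.mul_one, hX]

theorem conicObjective_mul (A : Matrix (Fin m) (Fin n) ℝ) (w : Fin (p + 1) → ℝ)
    (X : Matrix (Fin n) (Fin p) ℝ) {Q : Matrix (Fin p) (Fin p) ℝ} (hQ : Qᵀ * Q = 1) :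
    conicObjective A w (X * Q) = conicObjective A w X := by
  rw [conicObjective_eq, conicObjective_eq, conicSymm_gram_mul w _ X hQ,
    conicSymm_gram_mul w _ X hQ]

theorem transpose_gram (A : Matrix (Fin m) (Fin n) ℝ) : (Aᵀ * A)ᵀ = Aᵀ * A := by
  rw [transpose_mul, transpose_transpose]

theorem conicObjective_updateCol {Z : Matrix (Fin n) (Fin p) ℝ} {μ : Fin p → ℝ}
    (hZ : Z ∈ stiefel n p) (hd : Zᵀ * (Aᵀ * A) * Z = diagonal μ) (hμ : ∀ k, 0 ≤ μ k) (j : Fin p)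
    {y : Fin n → ℝ} (hy : y ⬝ᵥ y = 1) (hZy : Zᵀ *ᵥ y = 0) (a b : ℝ) :
    conicObjective A w (Z.updateCol j (a • Z.col j + b • y)) =
      (conicRest w μ j + a ^ 2 * (conicSymm w (Zᵀ * (Aᵀ * A) * Z) - conicRest w μ j)
        + b ^ 2 * (conicSymm w ((Z.updateCol j y)ᵀ * (Aᵀ * A) * Z.updateCol j y)
            - conicRest w μ j)
        + 2 * a * b * (conicSlope w μ j * (Z.col j ⬝ᵥ (Aᵀ * A) *ᵥ y))) /
      (conicSymm w 1 + (a ^ 2 + b ^ 2 - 1) * conicSlope w 1 j) := by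
  have hZ1 : Zᵀ * (1 : Matrix (Fin n) (Fin n) ℝ) * Z = diagonal (1 : Fin p → ℝ) := by
    rw [Matrix.mul_one, show Zᵀ * Z = 1 from hZ, diagonal_one']
  have hY : Z.updateCol j y ∈ stiefel n p :=
    updateCol_mem_stiefel hZ j hy fun k _ => congrFun hZy k
  have hY1 : (Z.updateCol j y)ᵀ * (1 : Matrix (Fin n) (Fin n) ℝ) * Z.updateCol j y = 1 := by
    rw [Matrix.mul_one]; exact hY
  have h0 : Z.col j ⬝ᵥ y = 0 := congrFun hZy j
  have hr := conicSymm_eq_rest_add w (transpose_one) hZ1 (fun _ => zero_le_one) j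
  rw [conicObjective_eq, conicSymm_updateCol_combination w (transpose_gram A) hd hμ,
    conicSymm_updateCol_combination w transpose_one hZ1 (fun _ => zero_le_one), hY1, one_mulVec, h0]
  rw [Pi.one_apply] at hr
  congr 1
  rw [show Zᵀ * (1 : Matrix (Fin n) (Fin n) ℝ) * Z = 1 by rw [Matrix.mul_one]; exact hZ] at hr ⊢
  rw [hr]
  ring

end Objective

/-! ### One-variable calculus -/

theorem hasDerivAt_tangent_variation (N σ k c s l : ℝ) (hc : c ≠ 0) :
    HasDerivAt (fun t : ℝ => (N + t ^ 2 * k + 2 * t * σ) / (c + t ^ 2 * s) + t ^ 2 * l)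
      (2 * σ / c) 0 := by
  have h2 : HasDerivAt (fun t : ℝ => t ^ 2) 0 0 := by simpa using hasDerivAt_pow 2 (0 : ℝ)
  have h1 : HasDerivAt (fun t : ℝ => 2 * t * σ) (2 * σ) 0 := by
    simpa using ((hasDerivAt_id (0 : ℝ)).const_mul 2).mul_const σ
  have hn := ((h2.mul_const k).const_add N).add h1
  have hd := (h2.mul_const s).const_add c
  have := (hn.div hd (by simpa using hc)).add (h2.mul_const l)
  refine this.congr_deriv ?_
  simp
  field_simp

theorem hasDerivAt_normal_variation (K N c s l : ℝ) (hc : c ≠ 0) :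
    HasDerivAt (fun t : ℝ => (K + (1 + t) ^ 2 * (N - K)) / (c + ((1 + t) ^ 2 - 1) * s)
      + (2 * t + t ^ 2) * l) (2 * ((N - K) / c - N * s / c ^ 2 + l)) 0 := by
  have h2 : HasDerivAt (fun t : ℝ => (1 + t) ^ 2) 2 0 := by
    refine (((hasDerivAt_id (0 : ℝ)).const_add 1).pow 2).congr_deriv ?_
    simp
  have h3 : HasDerivAt (fun t : ℝ => 2 * t + t ^ 2) 2 0 := by
    refine (((hasDerivAt_id (0 : ℝ)).const_mul 2).add (hasDerivAt_pow 2 (0 : ℝ))).congr_deriv ?_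
    simp
  have hn := (h2.mul_const (N - K)).const_add K
  have hd := ((h2.sub_const 1).mul_const s).const_add c
  have := (hn.div hd (by simpa using hc)).add (h3.mul_const l)
  refine this.congr_deriv ?_
  simp
  field_simp

theorem iteratedDeriv_two_tangent_variation (N k s l : ℝ) {c : ℝ} (hc : 0 < c) (hs : 0 ≤ s) :
    iteratedDeriv 2 (fun t : ℝ => (N + t ^ 2 * k) / (c + t ^ 2 * s) + t ^ 2 * l) 0
      = 2 * (k / c - N * s / c ^ 2 + l) := by
  have hpos : ∀ t : ℝ, c + t ^ 2 * s ≠ 0 := fun t => by positivity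
  have h2 : ∀ t : ℝ, HasDerivAt (fun t : ℝ => t ^ 2) (2 * t) t := fun t => by
    simpa using hasDerivAt_pow 2 t
  have hd : deriv (fun t : ℝ => (N + t ^ 2 * k) / (c + t ^ 2 * s) + t ^ 2 * l)
      = fun t => t * ((2 * k * c - 2 * N * s) / (c + t ^ 2 * s) ^ 2 + 2 * l) := by
    funext t
    refine HasDerivAt.deriv ?_
    have := ((((h2 t).mul_const k).const_add N).div (((h2 t).mul_const s).const_add c)
      (hpos t)).add ((h2 t).mul_const l)
    refine this.congr_deriv ?_
    have := hpos t
    field_simp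
    ring
  rw [iteratedDeriv_succ, iteratedDeriv_one, hd]
  refine HasDerivAt.deriv ?_
  have hq : DifferentiableAt ℝ
      (fun t : ℝ => (2 * k * c - 2 * N * s) / (c + t ^ 2 * s) ^ 2 + 2 * l) 0 := by
    refine DifferentiableAt.add_const _ (DifferentiableAt.div (by fun_prop) (by fun_prop) ?_)
    exact pow_ne_zero 2 (hpos 0)
  have := (hasDerivAt_id (0 : ℝ)).mul hq.hasDerivAt
  refine this.congr_deriv ?_
  simp
  field_simp

/-! ### Stationary points and local maximisers -/

section Stationary

variable {m n p : ℕ} {A : Matrix (Fin m) (Fin n) ℝ} {w : Fin (p + 1) → ℝ}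
  {X : Matrix (Fin n) (Fin p) ℝ} {Q : Matrix (Fin p) (Fin p) ℝ} {μ : Fin p → ℝ}

/-- At a stationary point the first variation vanishes in every one-column direction, and the
Hessian of the Lagrangian in that direction compares the values of `g_w` before and after replacing
the column. The multiplier drops out by testing stationarity also in the direction that rescales the
column. -/
theorem stiefelMultiplier_columnVariation {Λ : Matrix (Fin p) (Fin p) ℝ}
    (hΛ : IsStiefelMultiplier (conicObjective A w) X Λ) (hw : ∀ q, 0 ≤ w q)
    (hc : 0 < conicSymm w (1 : Matrix (Fin p) (Fin p) ℝ)) (hX : X ∈ stiefel n p) (hQ : Qᵀ * Q = 1)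
    (hd : (X * Q)ᵀ * (Aᵀ * A) * (X * Q) = diagonal μ) (hμ : ∀ k, 0 ≤ μ k) (j : Fin p)
    {y : Fin n → ℝ} (hy : y ⬝ᵥ y = 1) (hXy : Xᵀ *ᵥ y = 0) :
    conicSlope w μ j * ((X * Q).col j ⬝ᵥ (Aᵀ * A) *ᵥ y) = 0 ∧
    Xᵀ * columnVariation Q j y + (columnVariation Q j y)ᵀ * X = 0 ∧
    stiefelHessian (conicObjective A w) Λ X (columnVariation Q j y) =
      2 * ((conicSymm w (((X * Q).updateCol j y)ᵀ * (Aᵀ * A) * (X * Q).updateCol j y)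
        - conicSymm w (Xᵀ * (Aᵀ * A) * X)) / conicSymm w 1) := by
  have hXX : Xᵀ * X = 1 := hX
  have hQ' : Q * Qᵀ = 1 := mul_eq_one_comm.1 hQ
  have hZ : X * Q ∈ stiefel n p := mul_mem_stiefel hX hQ
  have hZy : (X * Q)ᵀ *ᵥ y = 0 := transpose_mul_mulVec_eq_zero hXy Q
  have hs : 0 ≤ conicSlope w 1 j := conicSlope_nonneg hw (fun _ => zero_le_one) j
  set e : Fin p → ℝ := Pi.single j 1 with he
  set P : Matrix (Fin p) (Fin p) ℝ := Q * vecMulVec e e * Qᵀ with hP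
  set z := (X * Q).col j with hz
  have hze : vecMulVec z e = X * Q * vecMulVec e e := by
    rw [mul_vecMulVec, he, mulVec_single_one]
  have hPt : Pᵀ = P := by simp [hP, transpose_vecMulVec, Matrix.mul_assoc]
  have hXDy : Xᵀ * columnVariation Q j y = 0 := by
    rw [columnVariation, ← Matrix.mul_assoc, mul_vecMulVec, hXy, zero_vecMulVec,
      Matrix.zero_mul]
  have hXDz : Xᵀ * columnVariation Q j z = P := by
    rw [columnVariation, ← he, hze, hP]
    simp only [← Matrix.mul_assoc, hXX, Matrix.one_mul]
  have hDy : (columnVariation Q j y)ᵀ * columnVariation Q j y = P := by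
    rw [columnVariation, ← he, hP, transpose_mul, transpose_vecMulVec, transpose_transpose,
      Matrix.mul_assoc, ← Matrix.mul_assoc (vecMulVec e y), vecMulVec_mul_vecMulVec, hy, one_smul,
      ← Matrix.mul_assoc]
  have hzz : z ⬝ᵥ z = 1 := by
    have : z ⬝ᵥ z = ((X * Q)ᵀ * (X * Q)) j j := rfl
    rw [this, show (X * Q)ᵀ * (X * Q) = 1 from hZ, one_apply_eq]
  have hDz : (columnVariation Q j z)ᵀ * columnVariation Q j z = P := by
    rw [columnVariation, ← he, hP, transpose_mul, transpose_vecMulVec, transpose_transpose,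
      Matrix.mul_assoc, ← Matrix.mul_assoc (vecMulVec e z), vecMulVec_mul_vecMulVec, hzz, one_smul,
      ← Matrix.mul_assoc]
  have hDyX : (columnVariation Q j y)ᵀ * X = 0 := by
    have := congrArg transpose hXDy
    rwa [transpose_mul, transpose_transpose, transpose_zero] at this
  have hDzX : (columnVariation Q j z)ᵀ * X = P := by
    have := congrArg transpose hXDz
    rwa [transpose_mul, transpose_transpose, hPt] at this
  set N := conicSymm w (Xᵀ * (Aᵀ * A) * X) with hN
  have hNZ : conicSymm w ((X * Q)ᵀ * (Aᵀ * A) * (X * Q)) = N := conicSymm_gram_mul w _ X hQ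
  set N' := conicSymm w (((X * Q).updateCol j y)ᵀ * (Aᵀ * A) * (X * Q).updateCol j y)
  set c := conicSymm w (1 : Matrix (Fin p) (Fin p) ℝ)
  set s := conicSlope w 1 j
  set K := conicRest w μ j
  set σ := conicSlope w μ j * (z ⬝ᵥ (Aᵀ * A) *ᵥ y)
  set l := trace (P * Λ)
  have hLy : ∀ t : ℝ, stiefelLagrangian (conicObjective A w) Λ
      (X + t • columnVariation Q j y) =
      (N + t ^ 2 * (N' - K) + 2 * t * σ) / (c + t ^ 2 * s) + t ^ 2 * l := by
    intro t
    have h1 : (X + t • columnVariation Q j y)ᵀ * (X + t • columnVariation Q j y) - 1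
        = t ^ 2 • P := by
      simp only [transpose_add, transpose_smul, Matrix.add_mul, Matrix.mul_add, Matrix.smul_mul,
        Matrix.mul_smul, hXX, hXDy, hDyX, hDy, smul_zero]
      module
    rw [stiefelLagrangian, h1, transpose_smul, hPt, Matrix.smul_mul, trace_smul, smul_eq_mul,
      ← conicObjective_mul A w _ hQ, add_columnVariation_mul hQ]
    have h2 := conicObjective_updateCol (w := w) hZ hd hμ j hy hZy 1 t
    rw [one_smul, hNZ] at h2
    rw [h2]
    congr 2 <;> ring
  have hLz : ∀ t : ℝ, stiefelLagrangian (conicObjective A w) Λ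
      (X + t • columnVariation Q j z) =
      (K + (1 + t) ^ 2 * (N - K)) / (c + ((1 + t) ^ 2 - 1) * s) + (2 * t + t ^ 2) * l := by
    intro t
    have h1 : (X + t • columnVariation Q j z)ᵀ * (X + t • columnVariation Q j z) - 1
        = (2 * t + t ^ 2) • P := by
      simp only [transpose_add, transpose_smul, Matrix.add_mul, Matrix.mul_add, Matrix.smul_mul,
        Matrix.mul_smul, hXX, hXDz, hDzX, hDz]
      module
    rw [stiefelLagrangian, h1, transpose_smul, hPt, Matrix.smul_mul, trace_smul, smul_eq_mul,
      ← conicObjective_mul A w _ hQ, add_columnVariation_mul hQ]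
    have h2 := conicObjective_updateCol (w := w) hZ hd hμ j hy hZy (1 + t) 0
    rw [zero_smul, add_zero, add_smul, one_smul, hNZ] at h2
    rw [h2]
    congr 2 <;> ring
  have hσ : σ = 0 := by
    have h := hΛ (columnVariation Q j y)
    rw [lineDeriv, funext hLy, (hasDerivAt_tangent_variation N σ (N' - K) c s l hc.ne').deriv] at h
    field_simp at h
    linarith
  have hl : (N - K) / c - N * s / c ^ 2 + l = 0 := by
    have h := hΛ (columnVariation Q j z)
    rw [lineDeriv, funext hLz, (hasDerivAt_normal_variation K N c s l hc.ne').deriv] at h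
    linarith
  refine ⟨hσ, by rw [hXDy, hDyX, add_zero], ?_⟩
  have hfun : (fun t : ℝ => stiefelLagrangian (conicObjective A w) Λ
      (X + t • columnVariation Q j y)) =
      fun t => (N + t ^ 2 * (N' - K)) / (c + t ^ 2 * s) + t ^ 2 * l := by
    funext t
    rw [hLy, hσ, mul_zero, add_zero]
  rw [stiefelHessian, hfun, iteratedDeriv_two_tangent_variation N (N' - K) s l hc hs]
  have : (N' - N) / c = (N' - K) / c - (N - K) / c := by ring
  rw [this]
  linarith

end Stationary

theorem exists_sin_pos_of_eventually {P : ℝ → Prop} (h : ∀ᶠ t in nhds (0 : ℝ), P t) :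
    ∃ t, 0 < Real.sin t ∧ P t := by
  obtain ⟨ε, hε, hball⟩ := Metric.eventually_nhds_iff.1 h
  have ht0 : 0 < min (ε / 2) 1 := lt_min (by linarith) one_pos
  refine ⟨min (ε / 2) 1, Real.sin_pos_of_pos_of_le_one ht0 (min_le_right _ _), hball ?_⟩
  rw [Real.dist_eq, sub_zero, abs_of_pos ht0]
  exact (min_le_left _ _).trans_lt (by linarith)

section LocalMax

variable {n p : ℕ} {B : Matrix (Fin n) (Fin n) ℝ} {w : Fin (p + 1) → ℝ}
  {X : Matrix (Fin n) (Fin p) ℝ} {Q : Matrix (Fin p) (Fin p) ℝ} {μ : Fin p → ℝ}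

/-- The curve in the Stiefel manifold that rotates the `j`-th column of the frame `X Q`
towards `y`. -/
def rotationCurve (X : Matrix (Fin n) (Fin p) ℝ) (Q : Matrix (Fin p) (Fin p) ℝ) (j : Fin p)
    (y : Fin n → ℝ) (t : ℝ) : Matrix (Fin n) (Fin p) ℝ :=
  (X * Q).updateCol j (Real.cos t • (X * Q).col j + Real.sin t • y) * Qᵀ

theorem rotationCurve_mem_stiefel (hX : X ∈ stiefel n p) (hQ : Qᵀ * Q = 1) (j : Fin p)
    {y : Fin n → ℝ} (hy : y ⬝ᵥ y = 1) (hXy : Xᵀ *ᵥ y = 0) (t : ℝ) :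
    rotationCurve X Q j y t ∈ stiefel n p :=
  mul_mem_stiefel (updateCol_rotation_mem_stiefel (mul_mem_stiefel hX hQ) j hy
    (transpose_mul_mulVec_eq_zero hXy Q) t)
    (by rw [transpose_transpose]; exact mul_eq_one_comm.1 hQ)

theorem rotationCurve_zero (hQ : Qᵀ * Q = 1) (j : Fin p) (y : Fin n → ℝ) :
    rotationCurve X Q j y 0 = X := by
  have h : (X * Q).updateCol j ((X * Q).col j) = X * Q := updateCol_eq_self _ _
  rw [rotationCurve, Real.cos_zero, Real.sin_zero, one_smul, zero_smul, add_zero, h,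
    Matrix.mul_assoc, mul_eq_one_comm.1 hQ, Matrix.mul_one]

theorem continuous_rotationCurve (X : Matrix (Fin n) (Fin p) ℝ) (Q : Matrix (Fin p) (Fin p) ℝ)
    (j : Fin p) (y : Fin n → ℝ) : Continuous (rotationCurve X Q j y) := by
  refine Continuous.matrix_mul ?_ continuous_const
  exact Continuous.matrix_updateCol _ continuous_const (by fun_prop)

theorem tendsto_rotationCurve (hX : X ∈ stiefel n p) (hQ : Qᵀ * Q = 1) (j : Fin p)
    {y : Fin n → ℝ} (hy : y ⬝ᵥ y = 1) (hXy : Xᵀ *ᵥ y = 0) :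
    Filter.Tendsto (rotationCurve X Q j y) (nhds 0) (nhdsWithin X (stiefel n p)) := by
  refine tendsto_nhdsWithin_iff.2 ⟨?_, Filter.Eventually.of_forall
    (rotationCurve_mem_stiefel hX hQ j hy hXy)⟩
  have := (continuous_rotationCurve X Q j y).tendsto 0
  rwa [rotationCurve_zero hQ] at this

theorem conicSymm_rotationCurve (w : Fin (p + 1) → ℝ) (hB : Bᵀ = B) (hQ : Qᵀ * Q = 1)
    (hd : (X * Q)ᵀ * B * (X * Q) = diagonal μ) (hμ : ∀ k, 0 ≤ μ k) (j : Fin p) (y : Fin n → ℝ)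
    (t : ℝ) :
    conicSymm w ((rotationCurve X Q j y t)ᵀ * B * rotationCurve X Q j y t) =
      conicSymm w (Xᵀ * B * X) + Real.sin t ^ 2 *
        (conicSymm w (((X * Q).updateCol j y)ᵀ * B * (X * Q).updateCol j y)
          - conicSymm w (Xᵀ * B * X))
      + 2 * Real.cos t * Real.sin t * (conicSlope w μ j * ((X * Q).col j ⬝ᵥ B *ᵥ y)) := by
  have hQ' : Qᵀᵀ * Qᵀ = 1 := by rw [transpose_transpose]; exact mul_eq_one_comm.1 hQ
  rw [rotationCurve, conicSymm_gram_mul w B _ hQ', conicSymm_updateCol_combination w hB hd hμ,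
    conicSymm_gram_mul w B X hQ]
  linear_combination (conicSymm w (Xᵀ * B * X) - conicRest w μ j) * Real.cos_sq_add_sin_sq t

/-- First- and second-order conditions at a local maximiser of `X ↦ g_w(Xᵀ B X)`; the weights may
have any sign, so that minimisers are covered too. -/
theorem isLocalMaxOn_columnVariation
    (h : IsLocalMaxOn (fun X => conicSymm w (Xᵀ * B * X)) (stiefel n p) X) (hB : Bᵀ = B)
    (hX : X ∈ stiefel n p) (hQ : Qᵀ * Q = 1)
    (hd : (X * Q)ᵀ * B * (X * Q) = diagonal μ) (hμ : ∀ k, 0 ≤ μ k) (j : Fin p)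
    {y : Fin n → ℝ} (hy : y ⬝ᵥ y = 1) (hXy : Xᵀ *ᵥ y = 0) :
    conicSlope w μ j * ((X * Q).col j ⬝ᵥ B *ᵥ y) = 0 ∧
    conicSymm w (((X * Q).updateCol j y)ᵀ * B * (X * Q).updateCol j y)
      ≤ conicSymm w (Xᵀ * B * X) := by
  have hev := (tendsto_rotationCurve hX hQ j hy hXy).eventually h
  simp only [conicSymm_rotationCurve w hB hQ hd hμ] at hev
  set N := conicSymm w (Xᵀ * B * X)
  set k := conicSymm w (((X * Q).updateCol j y)ᵀ * B * (X * Q).updateCol j y) - N with hk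
  set σ := conicSlope w μ j * ((X * Q).col j ⬝ᵥ B *ᵥ y)
  have hσ : σ = 0 := by
    have hloc : IsLocalMax (fun t : ℝ => N + Real.sin t ^ 2 * k + 2 * Real.cos t * Real.sin t * σ)
        0 := by
      filter_upwards [hev] with t ht
      simpa using ht
    have hder : HasDerivAt
        (fun t : ℝ => N + Real.sin t ^ 2 * k + 2 * Real.cos t * Real.sin t * σ) (2 * σ) 0 := by
      have h1 := (((Real.hasDerivAt_sin 0).pow 2).mul_const k).const_add N
      have h2 := (((Real.hasDerivAt_cos 0).const_mul 2).mul (Real.hasDerivAt_sin 0)).mul_const σ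
      refine (h1.add h2).congr_deriv ?_
      simp
    have := hloc.hasDerivAt_eq_zero hder
    linarith
  refine ⟨hσ, ?_⟩
  obtain ⟨t, hsin, h1⟩ := exists_sin_pos_of_eventually hev
  rw [hσ, mul_zero, add_zero] at h1
  have h2 : Real.sin t ^ 2 * k ≤ 0 := by linarith
  have h3 : k ≤ 0 := by
    by_contra hcon
    push Not at hcon
    have : 0 < Real.sin t ^ 2 * k := by positivity
    linarith
  linarith

end LocalMax

/-! ### Dominant invariant subspaces -/

/-- The columns of `X` span the same space as the first `p` vectors of some orthonormal eigenbasis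
of `B` whose eigenvalues are in nonincreasing order. -/
def IsDominant {n p : ℕ} (hpn : p ≤ n) (B : Matrix (Fin n) (Fin n) ℝ)
    (X : Matrix (Fin n) (Fin p) ℝ) : Prop :=
  ∃ (V : Matrix (Fin n) (Fin n) ℝ) (d : Fin n → ℝ), Vᵀ * V = 1 ∧ Antitone d ∧
    B * V = V * diagonal d ∧
    LinearMap.range X.mulVecLin = LinearMap.range (V.submatrix id (Fin.castLE hpn)).mulVecLin

theorem exists_eq_mul_of_range_le {n p k : ℕ} {X : Matrix (Fin n) (Fin k) ℝ}
    {Y : Matrix (Fin n) (Fin p) ℝ}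
    (h : LinearMap.range X.mulVecLin ≤ LinearMap.range Y.mulVecLin) :
    ∃ R : Matrix (Fin p) (Fin k) ℝ, X = Y * R := by
  have : ∀ j, ∃ c : Fin p → ℝ, Y *ᵥ c = X.col j := by
    intro j
    have : X.col j ∈ LinearMap.range X.mulVecLin := ⟨Pi.single j 1, by simp⟩
    exact h this
  choose c hc using this
  refine ⟨of fun i j => c j i, ?_⟩
  ext i j
  exact (congrFun (hc j) i).symm

theorem range_mulVecLin_mul_le {m n p : ℕ} (Y : Matrix (Fin m) (Fin n) ℝ)
    (R : Matrix (Fin n) (Fin p) ℝ) :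
    LinearMap.range (Y * R).mulVecLin ≤ LinearMap.range Y.mulVecLin := by
  rw [mulVecLin_mul]
  exact LinearMap.range_comp_le_range _ _

theorem range_mulVecLin_mul_orthogonal {n p : ℕ} (X : Matrix (Fin n) (Fin p) ℝ)
    {Q : Matrix (Fin p) (Fin p) ℝ} (hQ : Qᵀ * Q = 1) :
    LinearMap.range (X * Q).mulVecLin = LinearMap.range X.mulVecLin := by
  refine le_antisymm (range_mulVecLin_mul_le X Q) ?_
  have := range_mulVecLin_mul_le (X * Q) Qᵀ
  rwa [Matrix.mul_assoc, mul_eq_one_comm.1 hQ, Matrix.mul_one] at this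

/-- The ordered list of eigenvalues of a matrix is unique. -/
theorem antitone_eigenvalues_unique {n : ℕ} {B V V' : Matrix (Fin n) (Fin n) ℝ} {d d' : Fin n → ℝ}
    (hV : Vᵀ * V = 1) (hd : Antitone d) (hBV : B * V = V * diagonal d)
    (hV' : V'ᵀ * V' = 1) (hd' : Antitone d') (hBV' : B * V' = V' * diagonal d') : d = d' := by
  have key : ∀ {V : Matrix (Fin n) (Fin n) ℝ} {d : Fin n → ℝ}, Vᵀ * V = 1 →
      B * V = V * diagonal d →
      ∀ t : ℝ, (∏ i, (X - C (d i))).eval t = det (t • (1 : Matrix (Fin n) (Fin n) ℝ) - B) := by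
    intro V d hV hBV t
    have h1 : t • (1 : Matrix (Fin n) (Fin n) ℝ) - B
        = V * (t • (1 : Matrix (Fin n) (Fin n) ℝ) - diagonal d) * Vᵀ := by
      rw [Matrix.mul_sub, ← hBV, Matrix.sub_mul, Matrix.mul_assoc B, mul_eq_one_comm.1 hV,
        Matrix.mul_smul, Matrix.mul_one, Matrix.mul_one, Matrix.smul_mul, mul_eq_one_comm.1 hV]
    have h2 : t • (1 : Matrix (Fin n) (Fin n) ℝ) - diagonal d = diagonal fun i => t - d i := by
      ext i j
      by_cases h : i = j <;> simp [h, Matrix.sub_apply, Matrix.smul_apply, one_apply, diagonal]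
    rw [h1, det_mul_right_comm, mul_eq_one_comm.1 hV, Matrix.one_mul, h2, det_diagonal,
      eval_prod]
    simp
  have hpoly : ∏ i, (X - C (d i)) = ∏ i, (X - C (d' i)) :=
    Polynomial.funext fun t => by rw [key hV hBV, key hV' hBV']
  have hroots : ∀ d : Fin n → ℝ, (∏ i, (X - C (d i))).roots = (List.ofFn d : Multiset ℝ) := by
    intro d
    have : ∏ i, (X - C (d i)) = ((Finset.univ.val.map d).map fun a => X - C a).prod := by
      rw [Multiset.map_map]; rfl
    rw [this, roots_multiset_prod_X_sub_C, Fin.univ_val_map]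
  have hperm : (List.ofFn d).Perm (List.ofFn d') := by
    rw [← Multiset.coe_eq_coe, ← hroots, ← hroots, hpoly]
  exact List.ofFn_injective (hperm.eq_of_sortedGE hd.sortedGE_ofFn hd'.sortedGE_ofFn)

section Dominant

variable {n p : ℕ} {hpn : p ≤ n} {B : Matrix (Fin n) (Fin n) ℝ} {X Y : Matrix (Fin n) (Fin p) ℝ}

theorem gram_submatrix_castLE (hpn : p ≤ n) {V : Matrix (Fin n) (Fin n) ℝ} {d : Fin n → ℝ}
    (hV : Vᵀ * V = 1) (hBV : B * V = V * diagonal d) :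
    (V.submatrix id (Fin.castLE hpn))ᵀ * V.submatrix id (Fin.castLE hpn) = 1 ∧
    (V.submatrix id (Fin.castLE hpn))ᵀ * B * V.submatrix id (Fin.castLE hpn)
      = diagonal (d ∘ Fin.castLE hpn) := by
  have hinj : Function.Injective (Fin.castLE hpn) := Fin.castLE_injective hpn
  constructor
  · have : (V.submatrix id (Fin.castLE hpn))ᵀ * V.submatrix id (Fin.castLE hpn)
        = (Vᵀ * V).submatrix (Fin.castLE hpn) (Fin.castLE hpn) := rfl
    rw [this, hV, submatrix_one _ hinj]
  · have : (V.submatrix id (Fin.castLE hpn))ᵀ * B * V.submatrix id (Fin.castLE hpn)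
        = (Vᵀ * B * V).submatrix (Fin.castLE hpn) (Fin.castLE hpn) := rfl
    rw [this, Matrix.mul_assoc, hBV, ← Matrix.mul_assoc, hV, Matrix.one_mul,
      submatrix_diagonal _ _ hinj]

theorem IsDominant.add_smul_one (h : IsDominant hpn B X) (ε : ℝ) :
    IsDominant hpn (B + ε • 1) X := by
  obtain ⟨V, d, hV, hd, hBV, hr⟩ := h
  refine ⟨V, fun i => d i + ε, hV, fun i j hij => by simpa using hd hij, ?_, hr⟩
  have : diagonal (fun i => d i + ε) = diagonal d + ε • 1 := by
    ext i j
    by_cases h : i = j <;> simp [h, Matrix.add_apply, Matrix.smul_apply, one_apply, diagonal]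
  rw [this, Matrix.add_mul, hBV, Matrix.mul_add]
  simp

/-- The compressions of `B` to any two dominant frames are orthogonally similar. -/
theorem IsDominant.exists_similar (hX : X ∈ stiefel n p) (hY : Y ∈ stiefel n p)
    (h : IsDominant hpn B X) (h' : IsDominant hpn B Y) :
    ∃ R : Matrix (Fin p) (Fin p) ℝ, Rᵀ * R = 1 ∧ Yᵀ * B * Y = Rᵀ * (Xᵀ * B * X) * R := by
  obtain ⟨V, d, hV, hd, hBV, hr⟩ := h
  obtain ⟨W, e, hW, he, hBW, hs⟩ := h'
  obtain rfl := antitone_eigenvalues_unique hV hd hBV hW he hBW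
  obtain ⟨R, hR⟩ := exists_eq_mul_of_range_le hr.le
  obtain ⟨S, hS⟩ := exists_eq_mul_of_range_le hs.le
  obtain ⟨hV1, hV2⟩ := gram_submatrix_castLE hpn hV hBV
  obtain ⟨hW1, hW2⟩ := gram_submatrix_castLE hpn hW hBW
  set Vp := V.submatrix id (Fin.castLE hpn)
  set Wp := W.submatrix id (Fin.castLE hpn)
  have hRR : Rᵀ * R = 1 := by
    have hX : Xᵀ * X = 1 := hX
    rwa [hR, transpose_mul, Matrix.mul_assoc, ← Matrix.mul_assoc Vpᵀ, hV1, Matrix.one_mul] at hX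
  have hSS : Sᵀ * S = 1 := by
    have hY : Yᵀ * Y = 1 := hY
    rwa [hS, transpose_mul, Matrix.mul_assoc, ← Matrix.mul_assoc Wpᵀ, hW1, Matrix.one_mul] at hY
  have hRR' := mul_eq_one_comm.1 hRR
  refine ⟨Rᵀ * S, ?_, ?_⟩
  · rw [transpose_mul, transpose_transpose, Matrix.mul_assoc, ← Matrix.mul_assoc R, hRR',
      Matrix.one_mul, hSS]
  · rw [hR, hS, gram_mul B Wp S, gram_mul B Vp R, hV2, hW2, transpose_mul, transpose_transpose]
    simp only [Matrix.mul_assoc]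
    rw [← Matrix.mul_assoc R, hRR', Matrix.one_mul, ← Matrix.mul_assoc R, hRR', Matrix.one_mul]

/-- A partially defined orthonormal family extends to the columns of an orthogonal matrix. -/
theorem exists_orthogonal_col_eq {N : ℕ} (v : Fin N → Fin N → ℝ) (s : Set (Fin N))
    (h : ∀ i ∈ s, ∀ j ∈ s, v i ⬝ᵥ v j = if i = j then 1 else 0) :
    ∃ V : Matrix (Fin N) (Fin N) ℝ, Vᵀ * V = 1 ∧ ∀ i ∈ s, V.col i = v i := by
  set u : Fin N → EuclideanSpace ℝ (Fin N) := fun i => WithLp.toLp 2 (v i) with hu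
  have horth : Orthonormal ℝ (s.domRestrict u) := by
    rw [orthonormal_iff_ite]
    rintro ⟨i, hi⟩ ⟨j, hj⟩
    have h1 : inner ℝ (u i) (u j) = v j ⬝ᵥ v i := by
      simp only [hu]
      rw [EuclideanSpace.inner_toLp_toLp, star_trivial]
    refine (h1.trans (h j hj i hi)).trans ?_
    simp [eq_comm]
  obtain ⟨b, hb⟩ := horth.exists_orthonormalBasis_extension_of_card_eq (by simp)
  refine ⟨of fun a i => b i a, ?_, fun i hi => ?_⟩
  · ext i j
    have h1 := orthonormal_iff_ite.1 b.orthonormal j i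
    refine Eq.trans (b := inner ℝ (b j) (b i)) rfl ?_
    rw [h1, one_apply]
    simp [eq_comm]
  · ext a
    have h1 := hb i hi
    change b i a = v i a
    rw [h1]

/-- Orthonormal columns can be completed to an orthogonal matrix. -/
theorem exists_orthogonal_extension {p k : ℕ} {X : Matrix (Fin (p + k)) (Fin p) ℝ}
    (hX : X ∈ stiefel (p + k) p) :
    ∃ Y : Matrix (Fin (p + k)) (Fin k) ℝ, Yᵀ * Y = 1 ∧ Xᵀ * Y = 0 ∧ X * Xᵀ + Y * Yᵀ = 1 := by
  have hX : Xᵀ * X = 1 := hX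
  obtain ⟨V, hV, hVs⟩ := exists_orthogonal_col_eq
    (Fin.append (fun i => X.col i) (fun _ : Fin k => 0)) (Set.range (Fin.castAdd k)) (by
      rintro _ ⟨i, rfl⟩ _ ⟨j, rfl⟩
      rw [Fin.append_left, Fin.append_left]
      refine (congrFun (congrFun hX i) j).trans ?_
      simp [one_apply])
  have hVX : ∀ a i, V a (Fin.castAdd k i) = X a i := by
    intro a i
    have h1 := hVs (Fin.castAdd k i) ⟨i, rfl⟩
    rw [Fin.append_left] at h1
    exact congrFun h1 a
  have hVV : ∀ i j, ∑ a, V a i * V a j = (1 : Matrix (Fin (p + k)) (Fin (p + k)) ℝ) i j :=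
    fun i j => by rw [← hV]; rfl
  refine ⟨V.submatrix id (Fin.natAdd p), ?_, ?_, ?_⟩
  · have : (V.submatrix id (Fin.natAdd p))ᵀ * V.submatrix id (Fin.natAdd p)
        = (Vᵀ * V).submatrix (Fin.natAdd p) (Fin.natAdd p) := rfl
    rw [this, hV, submatrix_one _ (Fin.natAdd_injective k p)]
  · ext i j
    have h1 := hVV (Fin.castAdd k i) (Fin.natAdd p j)
    simp only [hVX] at h1
    rw [one_apply_ne (by simp [Fin.ext_iff]; omega)] at h1
    exact h1
  · have h1 := mul_eq_one_comm.1 hV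
    ext a b
    rw [← h1, mul_apply, Fin.sum_univ_add]
    simp only [transpose_apply, hVX]
    rfl

/-- An invariant frame whose eigenvalues dominate all eigenvalues with an eigenvector orthogonal to
it is dominant: ordered eigenbases of the range and of its complement fit together. -/
theorem isDominant_of_invariant (hpn : p ≤ n) (hB : Bᵀ = B) (hX : X ∈ stiefel n p)
    (hinv : B * X = X * (Xᵀ * B * X))
    (hcmp : ∀ (Q : Matrix (Fin p) (Fin p) ℝ) (μ : Fin p → ℝ) (j : Fin p) (y : Fin n → ℝ) (ν : ℝ),
      Qᵀ * Q = 1 → (X * Q)ᵀ * B * (X * Q) = diagonal μ → y ⬝ᵥ y = 1 → Xᵀ *ᵥ y = 0 →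
      B *ᵥ y = ν • y → ν ≤ μ j) : IsDominant hpn B X := by
  obtain ⟨k, rfl⟩ := Nat.exists_eq_add_of_le hpn
  obtain ⟨Y, hYY, hXY, hcompl⟩ := exists_orthogonal_extension hX
  have hXX : Xᵀ * X = 1 := hX
  have hXB : Xᵀ * B = Xᵀ * B * X * Xᵀ := by
    have := congrArg transpose hinv
    simp only [transpose_mul, transpose_transpose, hB, Matrix.mul_assoc] at this
    simpa only [Matrix.mul_assoc] using this
  have hXBY : Xᵀ * B * Y = 0 := by
    rw [hXB, Matrix.mul_assoc, hXY, Matrix.mul_zero]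
  have hinvY : B * Y = Y * (Yᵀ * B * Y) := by
    calc B * Y = (X * Xᵀ + Y * Yᵀ) * (B * Y) := by rw [hcompl, Matrix.one_mul]
      _ = X * (Xᵀ * B * Y) + Y * (Yᵀ * B * Y) := by
        rw [Matrix.add_mul]; simp only [Matrix.mul_assoc]
      _ = _ := by rw [hXBY, Matrix.mul_zero, zero_add]
  obtain ⟨Q, μ, hQ, hμ, hQd⟩ := exists_orthogonal_diagonalisation (M := Xᵀ * B * X)
    (by simp only [transpose_mul, transpose_transpose, hB, Matrix.mul_assoc])
  obtain ⟨S, ν, hS, hν, hSd⟩ := exists_orthogonal_diagonalisation (M := Yᵀ * B * Y)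
    (by simp only [transpose_mul, transpose_transpose, hB, Matrix.mul_assoc])
  have hBXQ : B * (X * Q) = X * Q * diagonal μ := by
    rw [← Matrix.mul_assoc, hinv, ← hQd]
    simp only [← Matrix.mul_assoc]
    rw [Matrix.mul_assoc X Q Qᵀ, mul_eq_one_comm.1 hQ, Matrix.mul_one]
  have hBYS : B * (Y * S) = Y * S * diagonal ν := by
    rw [← Matrix.mul_assoc, hinvY, ← hSd]
    simp only [← Matrix.mul_assoc]
    rw [Matrix.mul_assoc Y S Sᵀ, mul_eq_one_comm.1 hS, Matrix.mul_one]
  have h11 : (X * Q)ᵀ * (X * Q) = 1 := mul_mem_stiefel hX hQ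
  have h22 : (Y * S)ᵀ * (Y * S) = 1 := mul_mem_stiefel (X := Y) hYY hS
  have h12 : (X * Q)ᵀ * (Y * S) = 0 := by
    rw [transpose_mul, Matrix.mul_assoc, ← Matrix.mul_assoc Xᵀ, hXY, Matrix.zero_mul,
      Matrix.mul_zero]
  have h21 : (Y * S)ᵀ * (X * Q) = 0 := by
    have := congrArg transpose h12
    rwa [transpose_mul, transpose_transpose, transpose_zero] at this
  have hνμ : ∀ i j, ν j ≤ μ i := by
    intro i j
    refine hcmp Q μ i ((Y * S).col j) (ν j) hQ (by rw [gram_mul, hQd]) ?_ ?_ ?_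
    · have : (Y * S).col j ⬝ᵥ (Y * S).col j = ((Y * S)ᵀ * (Y * S)) j j := rfl
      rw [this, h22, one_apply_eq]
    · have h1 : Xᵀ * (Y * S) = 0 := by rw [← Matrix.mul_assoc, hXY, Matrix.zero_mul]
      ext i
      exact congrFun (congrFun h1 i) j
    · ext a
      have h1 : (B *ᵥ (Y * S).col j) a = (B * (Y * S)) a j := rfl
      rw [h1, hBYS, mul_diagonal, Pi.smul_apply, smul_eq_mul, mul_comm]
      rfl
  set V : Matrix (Fin (p + k)) (Fin (p + k)) ℝ :=
    of fun a => Fin.append ((X * Q) a) ((Y * S) a) with hVdef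
  have hVl : ∀ a i, V a (Fin.castAdd k i) = (X * Q) a i := fun a i => by simp [hVdef]
  have hVr : ∀ a i, V a (Fin.natAdd p i) = (Y * S) a i := fun a i => by simp [hVdef]
  refine ⟨V, Fin.append μ ν, ?_, ?_, ?_, ?_⟩
  · ext i j
    rw [mul_apply]
    induction i using Fin.addCases with
    | left i =>
      induction j using Fin.addCases with
      | left j =>
        simp only [transpose_apply, hVl]
        refine (congrFun (congrFun h11 i) j).trans ?_
        simp [one_apply]
      | right j =>
        simp only [transpose_apply, hVl, hVr]
        refine (congrFun (congrFun h12 i) j).trans ?_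
        rw [one_apply_ne (by simp [Fin.ext_iff]; omega), Matrix.zero_apply]
    | right i =>
      induction j using Fin.addCases with
      | left j =>
        simp only [transpose_apply, hVl, hVr]
        refine (congrFun (congrFun h21 i) j).trans ?_
        rw [one_apply_ne (by simp [Fin.ext_iff]; omega), Matrix.zero_apply]
      | right j =>
        simp only [transpose_apply, hVr]
        refine (congrFun (congrFun h22 i) j).trans ?_
        simp [one_apply]
  · intro i j hij
    induction i using Fin.addCases with
    | left i =>
      induction j using Fin.addCases with
      | left j =>
        simp only [Fin.append_left]
        have h : i ≤ j := Fin.le_def.2 (Fin.le_def.1 hij)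
        exact hμ h
      | right j =>
        simp only [Fin.append_left, Fin.append_right]
        exact hνμ i j
    | right i =>
      induction j using Fin.addCases with
      | left j =>
        exfalso
        have := Fin.le_def.1 hij
        simp at this
        omega
      | right j =>
        simp only [Fin.append_right]
        have h : i ≤ j := by
          have := Fin.le_def.1 hij
          simp only [Fin.val_natAdd] at this
          exact Fin.le_def.2 (by omega)
        exact hν h
  · ext a j
    rw [mul_diagonal, mul_apply]
    induction j using Fin.addCases with
    | left j =>
      simp only [hVl, Fin.append_left]
      have := congrFun (congrFun hBXQ a) j
      rwa [mul_diagonal, mul_apply] at this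
    | right j =>
      simp only [hVr, Fin.append_right]
      have := congrFun (congrFun hBYS a) j
      rwa [mul_diagonal, mul_apply] at this
  · have : V.submatrix id (Fin.castLE hpn) = X * Q := by
      ext a i
      exact hVl a i
    rw [this, range_mulVecLin_mul_orthogonal X hQ]

end Dominant

/-! ### Singular value decompositions -/

section SVD

variable {m n p : ℕ} {A : Matrix (Fin m) (Fin n) ℝ} {X : Matrix (Fin n) (Fin p) ℝ}

theorem IsLeadingRightSingularFactor.isDominant {hpn : p ≤ n} {Vp : Matrix (Fin n) (Fin p) ℝ}
    (h : IsLeadingRightSingularFactor hpn A Vp)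
    (hr : LinearMap.range X.mulVecLin = LinearMap.range Vp.mulVecLin) :
    IsDominant hpn (Aᵀ * A) X := by
  obtain ⟨U, V, σ, hU, hV, hσ, hanti, hA, rfl⟩ := h
  have hUU : Uᵀ * U = 1 := (mem_orthogonalGroup_iff' _ _).1 hU
  have hVV : Vᵀ * V = 1 := (mem_orthogonalGroup_iff' _ _).1 hV
  set D : Matrix (Fin m) (Fin n) ℝ :=
    of fun (i : Fin m) (j : Fin n) => if (i : ℕ) = (j : ℕ) then σ i else 0 with hD
  refine ⟨V, fun j => if (j : ℕ) < m then σ j ^ 2 else 0, hVV, ?_, ?_, hr⟩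
  · intro i j hij
    have hij' : (i : ℕ) ≤ j := hij
    have h1 := hanti hij'
    dsimp only
    split_ifs with h2 h3
    · have := hσ j
      gcongr
    · omega
    · positivity
    · rfl
  · have hDD : Dᵀ * D = diagonal fun j : Fin n => if (j : ℕ) < m then σ j ^ 2 else 0 := by
      ext a b
      rw [mul_apply, diagonal_apply]
      simp only [transpose_apply, hD, of_apply]
      by_cases ha : (a : ℕ) < m
      · rw [Finset.sum_eq_single (⟨a, ha⟩ : Fin m)]
        · by_cases hab : a = b
          · subst hab
            simp [ha, pow_two]
          · have : (a : ℕ) ≠ b := fun h => hab (Fin.ext h)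
            simp [hab, this]
        · intro i _ hi
          have : (i : ℕ) ≠ a := fun h => hi (Fin.ext h)
          simp [this]
        · simp
      · rw [Finset.sum_eq_zero]
        · simp [ha]
        · intro i _
          have : (i : ℕ) ≠ a := fun h => ha (h ▸ i.2)
          simp [this]
    rw [← hDD, hA]
    simp only [transpose_mul, transpose_transpose, Matrix.mul_assoc]
    rw [hVV, Matrix.mul_one, ← Matrix.mul_assoc Uᵀ, hUU, Matrix.one_mul]

/-- An ordered orthonormal eigenbasis of `Aᵀ A` is the right factor of a singular value
decomposition of `A`; the left factor extends the normalised vectors `A v_j`. -/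
theorem IsDominant.exists_isLeadingRightSingularFactor {hpn : p ≤ n}
    (h : IsDominant hpn (Aᵀ * A) X) : ∃ Vp, IsLeadingRightSingularFactor hpn A Vp ∧
      LinearMap.range X.mulVecLin = LinearMap.range Vp.mulVecLin := by
  obtain ⟨V, d, hV, hd, hBV, hr⟩ := h
  refine ⟨_, ?_, hr⟩
  set W := A * V with hW
  have hWW : Wᵀ * W = diagonal d := by
    rw [hW, transpose_mul, Matrix.mul_assoc, ← Matrix.mul_assoc Aᵀ, hBV, ← Matrix.mul_assoc, hV,
      Matrix.one_mul]
  have hcol : ∀ i j, W.col i ⬝ᵥ W.col j = diagonal d i j := fun i j => by rw [← hWW]; rfl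
  have hd0 : ∀ j, 0 ≤ d j := fun j => by
    have := hcol j j
    rw [diagonal_apply_eq] at this
    rw [← this]
    exact Finset.sum_nonneg fun i _ => mul_self_nonneg _
  have hW0 : ∀ j, d j = 0 → W.col j = 0 := fun j hj => by
    have := hcol j j
    rw [diagonal_apply_eq, hj] at this
    exact dotProduct_self_eq_zero.1 this
  -- more than `m` orthogonal vectors in `ℝ ^ m` cannot all be nonzero
  have hdm : ∀ j : Fin n, m ≤ j → d j = 0 := by
    intro j hj
    by_contra hne
    have h1 : (diagonal d).rank ≤ m := by
      rw [← hWW, rank_transpose_mul_self]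
      exact (rank_le_card_height W).trans (by simp)
    rw [rank_diagonal, Fintype.card_subtype] at h1
    have h2 : Finset.Iic j ⊆ Finset.univ.filter fun i => d i ≠ 0 := by
      intro i hi
      have h3 := hd (Finset.mem_Iic.1 hi)
      have h4 : 0 < d j := lt_of_le_of_ne (hd0 j) (Ne.symm hne)
      exact Finset.mem_filter.2 ⟨Finset.mem_univ _, (h4.trans_le h3).ne'⟩
    have h3 := Finset.card_le_card h2
    rw [Fin.card_Iic] at h3
    omega
  set σ : ℕ → ℝ := fun k => if h : k < n then Real.sqrt (d ⟨k, h⟩) else 0 with hσ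
  have hσj : ∀ j : Fin n, σ j = Real.sqrt (d j) := fun j => by simp [hσ]
  set v : Fin m → Fin m → ℝ := fun i =>
    if h : (i : ℕ) < n then (σ i)⁻¹ • W.col ⟨i, h⟩ else 0 with hv
  have hsn : ∀ i : Fin m, σ i ≠ 0 → (i : ℕ) < n := by
    intro i hi
    by_contra h
    exact hi (by simp [hσ, h])
  have horth : ∀ i ∈ {i : Fin m | σ i ≠ 0}, ∀ j ∈ {i : Fin m | σ i ≠ 0},
      v i ⬝ᵥ v j = if i = j then 1 else 0 := by
    intro i (hi : σ i ≠ 0) j (hj : σ j ≠ 0)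
    have hi' := hsn i hi
    have hj' := hsn j hj
    have h1 : v i ⬝ᵥ v j = (σ i)⁻¹ * (σ j)⁻¹ * (W.col ⟨i, hi'⟩ ⬝ᵥ W.col ⟨j, hj'⟩) := by
      simp only [hv, hi', hj', dif_pos]
      rw [smul_dotProduct, dotProduct_smul, smul_eq_mul, smul_eq_mul, mul_assoc]
    rw [h1, hcol, diagonal_apply]
    by_cases hij : i = j
    · subst hij
      have h2 : σ i * σ i = d ⟨i, hi'⟩ := by
        have := hσj ⟨i, hi'⟩
        simp only at this
        rw [this, Real.mul_self_sqrt (hd0 _)]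
      simp only [if_true, ← h2]
      field_simp
    · have : (i : ℕ) ≠ j := fun h => hij (Fin.ext h)
      simp [hij, this]
  obtain ⟨U, hU, hUs⟩ := exists_orthogonal_col_eq v _ horth
  refine ⟨U, V, σ, ?_, ?_, ?_, ?_, ?_, rfl⟩
  · exact (mem_orthogonalGroup_iff' _ _).2 hU
  · exact (mem_orthogonalGroup_iff' _ _).2 hV
  · intro k
    simp only [hσ]
    split_ifs
    · exact Real.sqrt_nonneg _
    · exact le_rfl
  · intro k l hkl
    simp only [hσ]
    split_ifs with h1 h2
    · exact Real.sqrt_le_sqrt (hd hkl)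
    · omega
    · exact Real.sqrt_nonneg _
    · exact le_rfl
  · have hWU : W = U * of fun (i : Fin m) (j : Fin n) => if (i : ℕ) = (j : ℕ) then σ i else 0 := by
      ext a j
      rw [mul_apply]
      simp only [of_apply, mul_ite, mul_zero]
      by_cases hj : (j : ℕ) < m
      · rw [Finset.sum_eq_single (⟨j, hj⟩ : Fin m)]
        · simp only [if_true]
          by_cases h0 : σ j = 0
          · have h1 : d j = 0 := by
              rw [hσj] at h0
              exact (Real.sqrt_eq_zero (hd0 j)).1 h0
            rw [h0, mul_zero]
            exact congrFun (hW0 j h1) a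
          · have h1 := congrFun (hUs ⟨j, hj⟩ h0) a
            have h2 : U a ⟨j, hj⟩ = (σ j)⁻¹ * W a j := by
              refine h1.trans ?_
              simp [hv]
            rw [h2]
            field_simp
        · intro i _ hi
          have : (i : ℕ) ≠ j := fun h => hi (Fin.ext h)
          simp [this]
        · simp
      · rw [Finset.sum_eq_zero]
        · exact congrFun (hW0 j (hdm j (not_lt.1 hj))) a
        · intro i _
          have : (i : ℕ) ≠ j := fun h => hj (h ▸ i.2)
          simp [this]
    rw [← hWU, hW, Matrix.mul_assoc, mul_eq_one_comm.1 hV, Matrix.mul_one]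

end SVD

/-! ### Continuity and compactness -/

theorem continuous_conicSymm {p : ℕ} (w : Fin (p + 1) → ℝ) :
    Continuous (conicSymm w : Matrix (Fin p) (Fin p) ℝ → ℝ) := by
  -- continuity of all coefficients is preserved by finite products
  have hprod : ∀ {ι : Type} (s : Finset ι) (F : ι → Matrix (Fin p) (Fin p) ℝ → ℝ[X]),
      (∀ i q, Continuous fun M => (F i M).coeff q) →
      ∀ q, Continuous fun M => (∏ i ∈ s, F i M).coeff q := by
    classical
    intro ι s F hF
    induction s using Finset.induction_on with
    | empty => intro q; simpa using continuous_const
    | insert a s ha ih =>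
      intro q
      simp only [Finset.prod_insert ha, coeff_mul]
      exact continuous_finsetSum _ fun x _ => (hF a x.1).mul (ih x.2)
  have hcoeff : ∀ q, Continuous fun M : Matrix (Fin p) (Fin p) ℝ => esymmMatrix q M := by
    intro q
    simp only [esymmMatrix, det_apply, finsetSum_coeff]
    refine continuous_finsetSum _ fun σ _ => ?_
    simp only [coeff_smul]
    refine Continuous.const_smul (hprod _ _ (fun i r => ?_) q) _
    have : ∀ M : Matrix (Fin p) (Fin p) ℝ, ((1 + (X : ℝ[X]) • M.map C) (σ i) i).coeff r
        = ((1 : Matrix (Fin p) (Fin p) ℝ[X]) (σ i) i).coeff r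
          + if r = 1 then M (σ i) i else 0 := by
      intro M
      change ((1 : Matrix (Fin p) (Fin p) ℝ[X]) (σ i) i + X * C (M (σ i) i)).coeff r = _
      rw [coeff_add, mul_comm, coeff_C_mul_X]
    simp only [this]
    split_ifs
    · exact continuous_const.add (continuous_id.matrix_elem _ _)
    · exact continuous_const
  exact continuous_finsetSum _ fun q _ => continuous_const.mul (hcoeff q)

theorem continuous_conicSymm_gram {n p : ℕ} (w : Fin (p + 1) → ℝ) (B : Matrix (Fin n) (Fin n) ℝ) :
    Continuous fun X : Matrix (Fin n) (Fin p) ℝ => conicSymm w (Xᵀ * B * X) := by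
  refine (continuous_conicSymm w).comp ?_
  fun_prop

theorem isCompact_stiefel (n p : ℕ) : IsCompact (stiefel n p) := by
  have hK : IsCompact (Set.univ.pi fun _ : Fin n => Set.univ.pi fun _ : Fin p =>
      Set.Icc (-1 : ℝ) 1) := isCompact_univ_pi fun _ => isCompact_univ_pi fun _ => isCompact_Icc
  refine IsCompact.of_isClosed_subset hK ?_ ?_
  · exact isClosed_eq (by fun_prop) continuous_const
  · intro X hX i _ j _
    have hX : Xᵀ * X = 1 := hX
    have h1 : ∑ k, X k j * X k j = 1 := by
      have := congrFun (congrFun hX j) j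
      rwa [mul_apply, one_apply_eq] at this
    have h2 : X i j * X i j ≤ 1 := by
      rw [← h1]
      exact Finset.single_le_sum (f := fun k => X k j * X k j) (fun k _ => mul_self_nonneg _)
        (Finset.mem_univ i)
    exact abs_le.1 ((sq_le_one_iff_abs_le_one _).1 (by rw [pow_two]; exact h2))

theorem stiefel_nonempty {n p : ℕ} (hpn : p ≤ n) : (stiefel n p).Nonempty :=
  ⟨_, (gram_submatrix_castLE (B := 0) (d := 0) (V := 1) hpn (by simp) (by simp)).1⟩

theorem exists_isMaxOn_stiefel {n p : ℕ} (hpn : p ≤ n) (w : Fin (p + 1) → ℝ)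
    (B : Matrix (Fin n) (Fin n) ℝ) :
    ∃ X ∈ stiefel n p, IsMaxOn (fun X => conicSymm w (Xᵀ * B * X)) (stiefel n p) X :=
  (isCompact_stiefel n p).exists_isMaxOn (stiefel_nonempty hpn)
    (continuous_conicSymm_gram w B).continuousOn

/-! ### One-column optimality implies dominance -/

section Column

variable {n p : ℕ} {B : Matrix (Fin n) (Fin n) ℝ} {w : Fin (p + 1) → ℝ}
  {X : Matrix (Fin n) (Fin p) ℝ} {Q : Matrix (Fin p) (Fin p) ℝ} {μ : Fin p → ℝ}

/-- In every frame that diagonalises `Xᵀ B X`, the first variation of `g_w(Xᵀ B X)` vanishes when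
a column is rotated towards a vector orthogonal to the range of `X`. -/
def ColumnStationary (w : Fin (p + 1) → ℝ) (B : Matrix (Fin n) (Fin n) ℝ)
    (X : Matrix (Fin n) (Fin p) ℝ) : Prop :=
  ∀ (Q : Matrix (Fin p) (Fin p) ℝ) (μ : Fin p → ℝ) (j : Fin p) (y : Fin n → ℝ),
    Qᵀ * Q = 1 → (X * Q)ᵀ * B * (X * Q) = diagonal μ → y ⬝ᵥ y = 1 → Xᵀ *ᵥ y = 0 →
    conicSlope w μ j * ((X * Q).col j ⬝ᵥ B *ᵥ y) = 0

/-- In every frame that diagonalises `Xᵀ B X`, replacing one column by a unit vector orthogonal to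
the range of `X` does not increase `g_w`. -/
def ColumnMaximal (w : Fin (p + 1) → ℝ) (B : Matrix (Fin n) (Fin n) ℝ)
    (X : Matrix (Fin n) (Fin p) ℝ) : Prop :=
  ∀ (Q : Matrix (Fin p) (Fin p) ℝ) (μ : Fin p → ℝ) (j : Fin p) (y : Fin n → ℝ),
    Qᵀ * Q = 1 → (X * Q)ᵀ * B * (X * Q) = diagonal μ → y ⬝ᵥ y = 1 → Xᵀ *ᵥ y = 0 →
    conicSymm w (((X * Q).updateCol j y)ᵀ * B * (X * Q).updateCol j y)
      ≤ conicSymm w (Xᵀ * B * X)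

theorem Matrix.PosSemidef.gram {k l : ℕ} {M : Matrix (Fin k) (Fin k) ℝ} (hM : M.PosSemidef)
    (Y : Matrix (Fin k) (Fin l) ℝ) : (Yᵀ * M * Y).PosSemidef := by
  have := hM.conjTranspose_mul_mul_same Y
  rwa [conjTranspose_eq_transpose_of_trivial] at this

theorem nonneg_of_gram_eq_diagonal (hB : B.PosSemidef) {Z : Matrix (Fin n) (Fin p) ℝ}
    (hd : Zᵀ * B * Z = diagonal μ) (k : Fin p) : 0 ≤ μ k := by
  have := (hB.gram Z).diag_nonneg (i := k)
  rwa [hd, diagonal_apply_eq] at this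

theorem rank_gram_eq_card (hQ : Qᵀ * Q = 1) (hd : (X * Q)ᵀ * B * (X * Q) = diagonal μ) :
    (Xᵀ * B * X).rank = (Finset.univ.filter fun k => μ k ≠ 0).card := by
  have hu : IsUnit Q.det := Matrix.isUnit_det_of_left_inverse hQ
  have hu' : IsUnit Qᵀ.det := by rwa [det_transpose]
  rw [← Fintype.card_subtype, ← rank_diagonal, ← hd, gram_mul,
    rank_mul_eq_left_of_isUnit_det _ _ hu, rank_mul_eq_right_of_isUnit_det _ _ hu']

/-- Off the minimal level `w 0` of `g_w` all slopes are positive. -/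
theorem conicSlope_pos_of_ne (hw : ∀ q, 0 ≤ w q) (hB : B.PosSemidef)
    (hne : conicSymm w (Xᵀ * B * X) ≠ w 0) (hQ : Qᵀ * Q = 1)
    (hd : (X * Q)ᵀ * B * (X * Q) = diagonal μ) (j : Fin p) : 0 < conicSlope w μ j := by
  obtain ⟨q, hq, hwq, hr⟩ := exists_le_rank_of_weight_zero_ne (hB.gram X) hne
  exact conicSlope_pos hw (nonneg_of_gram_eq_diagonal hB hd) j hq hwq
    (rank_gram_eq_card hQ hd ▸ hr)

theorem isLocalMaxOn_columnStationary (hB : B.PosSemidef) (hX : X ∈ stiefel n p)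
    (h : IsLocalMaxOn (fun X => conicSymm w (Xᵀ * B * X)) (stiefel n p) X) :
    ColumnStationary w B X := fun _ _ j _ hQ hd hy hXy =>
  (isLocalMaxOn_columnVariation h hB.transpose_eq hX hQ hd
    (nonneg_of_gram_eq_diagonal hB hd) j hy hXy).1

theorem isLocalMaxOn_columnMaximal (hB : B.PosSemidef) (hX : X ∈ stiefel n p)
    (h : IsLocalMaxOn (fun X => conicSymm w (Xᵀ * B * X)) (stiefel n p) X) :
    ColumnMaximal w B X := fun _ _ j _ hQ hd hy hXy =>
  (isLocalMaxOn_columnVariation h hB.transpose_eq hX hQ hd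
    (nonneg_of_gram_eq_diagonal hB hd) j hy hXy).2

/-- With all slopes nonzero, first-order stationarity makes the range of `X` invariant. -/
theorem ColumnStationary.invariant (h : ColumnStationary w B X) (hw : ∀ q, 0 ≤ w q)
    (hB : B.PosSemidef) (hX : X ∈ stiefel n p) (hne : conicSymm w (Xᵀ * B * X) ≠ w 0) :
    B * X = X * (Xᵀ * B * X) := by
  have hBt := hB.transpose_eq
  have hXX : Xᵀ * X = 1 := hX
  obtain ⟨Q, μ, hQ, -, hd⟩ := exists_orthogonal_diagonalisation (hB.gram X).transpose_eq
  rw [← gram_mul] at hd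
  have horth : ∀ y, Xᵀ *ᵥ y = 0 → (X * Q)ᵀ *ᵥ (B *ᵥ y) = 0 := by
    intro y hXy
    by_cases hy0 : y = 0
    · simp [hy0]
    have hyy : 0 < y ⬝ᵥ y := lt_of_le_of_ne (Finset.sum_nonneg fun i _ => mul_self_nonneg _)
      fun h0 => hy0 (dotProduct_self_eq_zero.1 h0.symm)
    have hsq := Real.mul_self_sqrt hyy.le
    have hs : Real.sqrt (y ⬝ᵥ y) ≠ 0 := (Real.sqrt_pos.2 hyy).ne'
    ext j
    have h1 := h Q μ j ((Real.sqrt (y ⬝ᵥ y))⁻¹ • y) hQ hd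
      (by
        rw [smul_dotProduct, dotProduct_smul, smul_eq_mul, smul_eq_mul]
        nth_rewrite 3 [← hsq]
        field_simp)
      (by rw [mulVec_smul, hXy, smul_zero])
    rw [mulVec_smul, dotProduct_smul, smul_eq_mul] at h1
    rcases mul_eq_zero.1 h1 with h2 | h2
    · exact absurd h2 (conicSlope_pos_of_ne hw hB hne hQ hd j).ne'
    · rcases mul_eq_zero.1 h2 with h3 | h3
      · exact absurd h3 (inv_ne_zero hs)
      · exact h3
  have h1 : (X * Q)ᵀ * B * (1 - X * Xᵀ) = 0 := by
    refine ext_of_mulVec_single fun i => ?_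
    rw [← mulVec_mulVec, ← mulVec_mulVec, horth, zero_mulVec]
    rw [mulVec_mulVec, Matrix.mul_sub, ← Matrix.mul_assoc, hXX, Matrix.one_mul, Matrix.mul_one,
      sub_self, zero_mulVec]
  have h2 : Xᵀ * B = Xᵀ * B * X * Xᵀ := by
    have h3 := congrArg (Q * ·) h1
    simp only [Matrix.mul_zero, transpose_mul, Matrix.mul_assoc] at h3
    rw [← Matrix.mul_assoc Q, mul_eq_one_comm.1 hQ, Matrix.one_mul, Matrix.mul_sub,
      Matrix.mul_one, Matrix.mul_sub, sub_eq_zero] at h3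
    simpa only [Matrix.mul_assoc] using h3
  have h4 := congrArg transpose h2
  simp only [transpose_mul, transpose_transpose, hBt] at h4
  rw [h4]
  simp only [Matrix.mul_assoc]

theorem ColumnStationary.isDominant (hpn : p ≤ n) (h : ColumnStationary w B X)
    (hmax : ColumnMaximal w B X) (hw : ∀ q, 0 ≤ w q) (hB : B.PosSemidef) (hX : X ∈ stiefel n p)
    (hne : conicSymm w (Xᵀ * B * X) ≠ w 0) : IsDominant hpn B X := by
  refine isDominant_of_invariant hpn hB.transpose_eq hX (h.invariant hw hB hX hne) ?_
  intro Q μ j y ν hQ hd hy hXy hν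
  have h1 := hmax Q μ j y hQ hd hy hXy
  rw [conicSymm_updateCol_eigenvector w hB.transpose_eq hd (nonneg_of_gram_eq_diagonal hB hd) j hy
    (transpose_mul_mulVec_eq_zero hXy Q) hν, conicSymm_gram_mul w B X hQ] at h1
  have h2 := conicSlope_pos_of_ne hw hB hne hQ hd j
  by_contra hlt
  push Not at hlt
  have := mul_pos (sub_pos.2 hlt) h2
  linarith

theorem conicSymm_neg (w : Fin (p + 1) → ℝ) (M : Matrix (Fin p) (Fin p) ℝ) :
    conicSymm (-w) M = -conicSymm w M := by
  simp [conicSymm]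

theorem conicSlope_neg (w : Fin (p + 1) → ℝ) (μ : Fin p → ℝ) (j : Fin p) :
    conicSlope (-w) μ j = -conicSlope w μ j := by
  simp [conicSlope, coeffFunctional_apply]

/-- The counterpart for minimisation: the eigenvalues of `B` on the range of `X` are the smallest
ones. -/
theorem ColumnStationary.isDominant_neg (hpn : p ≤ n) (h : ColumnStationary w B X)
    (hmin : ColumnMaximal (-w) B X) (hw : ∀ q, 0 ≤ w q) (hB : B.PosSemidef) (hX : X ∈ stiefel n p)
    (hne : conicSymm w (Xᵀ * B * X) ≠ w 0) : IsDominant hpn (-B) X := by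
  have hinv := h.invariant hw hB hX hne
  refine isDominant_of_invariant hpn (by rw [transpose_neg, hB.transpose_eq]) hX ?_ ?_
  · rw [Matrix.neg_mul, hinv]
    simp only [Matrix.mul_neg, Matrix.neg_mul]
  intro Q μ j y ν hQ hd hy hXy hν
  have hd' : (X * Q)ᵀ * B * (X * Q) = diagonal (-μ) := by
    rw [show diagonal (-μ) = -diagonal μ from (diagonal_neg μ).symm, ← hd]
    simp
  have hν' : B *ᵥ y = (-ν) • y := by
    rw [neg_smul, ← hν, neg_mulVec, neg_neg]
  have h1 := hmin Q (-μ) j y hQ hd' hy hXy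
  rw [conicSymm_neg, conicSymm_neg,
    conicSymm_updateCol_eigenvector w hB.transpose_eq hd' (nonneg_of_gram_eq_diagonal hB hd') j hy
    (transpose_mul_mulVec_eq_zero hXy Q) hν', conicSymm_gram_mul w B X hQ, Pi.neg_apply] at h1
  have h2 := conicSlope_pos_of_ne hw hB hne hQ hd' j
  by_contra hlt
  push Not at hlt
  have := mul_pos (sub_pos.2 hlt) h2
  linarith

/-- Invariant frames belonging to the smallest eigenvalues are global minimisers. The minimal level
of `g_w` carries no spectral information, so `B` is first shifted by `ε > 0`, where every minimiser
belongs to the smallest eigenvalues, and then `ε` tends to `0`. -/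
theorem IsDominant.isMinOn {hpn : p ≤ n} (hw : ∀ q, 0 ≤ w q)
    (hwq : ∃ q : Fin (p + 1), 1 ≤ (q : ℕ) ∧ w q ≠ 0) (hB : B.PosSemidef) (hX : X ∈ stiefel n p)
    (h : IsDominant hpn (-B) X) :
    IsMinOn (fun X => conicSymm w (Xᵀ * B * X)) (stiefel n p) X := by
  obtain ⟨q, hq, hwq⟩ := hwq
  intro Y hY
  have key : ∀ ε : ℝ, 0 < ε → conicSymm w (Xᵀ * (B + ε • 1) * X)
      ≤ conicSymm w (Yᵀ * (B + ε • 1) * Y) := by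
    intro ε hε
    have hone : (1 : Matrix (Fin n) (Fin n) ℝ).PosSemidef := PosSemidef.one
    have hB' : (B + ε • (1 : Matrix (Fin n) (Fin n) ℝ)).PosSemidef := hB.add (hone.smul hε.le)
    obtain ⟨W, hW, hWmax⟩ := exists_isMaxOn_stiefel hpn (-w) (B + ε • 1)
    have hst : ColumnStationary w (B + ε • 1) W := by
      intro Q μ j y hQ hd hy hWy
      have h1 := isLocalMaxOn_columnStationary hB' hW hWmax.localize Q μ j y hQ hd hy hWy
      rwa [conicSlope_neg, neg_mul, neg_eq_zero] at h1
    have hne : conicSymm w (Wᵀ * (B + ε • 1) * W) ≠ w 0 := by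
      have hWW : Wᵀ * W = 1 := hW
      have h1 : (Wᵀ * (B + ε • 1) * W).PosDef := by
        rw [Matrix.mul_add, Matrix.add_mul, Matrix.mul_smul, Matrix.smul_mul, Matrix.mul_one, hWW]
        exact PosDef.posSemidef_add (hB.gram W) (PosDef.one.smul hε)
      refine (weight_zero_lt_conicSymm hw (hB'.gram W) hq hwq ?_).ne'
      rw [rank_of_isUnit _ h1.isUnit, Fintype.card_fin]
      exact Nat.lt_succ_iff.1 q.2
    have hdom := hst.isDominant_neg hpn
      (isLocalMaxOn_columnMaximal hB' hW hWmax.localize) hw hB' hW hne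
    have hdomX : IsDominant hpn (-(B + ε • 1)) X := by
      have := h.add_smul_one (-ε)
      rwa [neg_smul, ← neg_add] at this
    obtain ⟨R, hR, hsim⟩ := hdomX.exists_similar hX hW hdom
    have hsim' : Wᵀ * (B + ε • 1) * W = Rᵀ * (Xᵀ * (B + ε • 1) * X) * R := by
      simpa only [Matrix.mul_neg, Matrix.neg_mul, neg_inj] using hsim
    rw [← conicSymm_conj w _ hR, ← hsim']
    have := hWmax hY
    simp only [Set.mem_ofPred_eq, conicSymm_neg] at this
    linarith
  have hcont : ∀ Z : Matrix (Fin n) (Fin p) ℝ,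
      Continuous fun ε : ℝ => conicSymm w (Zᵀ * (B + ε • 1) * Z) := fun Z =>
    (continuous_conicSymm w).comp (by fun_prop)
  have hlim : ∀ Z : Matrix (Fin n) (Fin p) ℝ, Filter.Tendsto
      (fun ε : ℝ => conicSymm w (Zᵀ * (B + ε • 1) * Z)) (nhdsWithin 0 (Set.Ioi 0))
      (nhds (conicSymm w (Zᵀ * B * Z))) := fun Z => by
    have := ((hcont Z).tendsto 0).mono_left (nhdsWithin_le_nhds (s := Set.Ioi 0))
    rwa [zero_smul, add_zero] at this
  exact le_of_tendsto_of_tendsto (hlim X) (hlim Y)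
    (eventually_nhdsWithin_of_forall fun ε hε => key ε hε)

end Column

/-! ### Increasing the rank -/

section Rank

variable {m n p : ℕ} {A : Matrix (Fin m) (Fin n) ℝ} {w : Fin (p + 1) → ℝ}
  {X Z : Matrix (Fin n) (Fin p) ℝ}

theorem posSemidef_gram (A : Matrix (Fin m) (Fin n) ℝ) : (Aᵀ * A).PosSemidef := by
  have := posSemidef_conjTranspose_mul_self A
  rwa [conjTranspose_eq_transpose_of_trivial] at this

theorem rank_gram (A : Matrix (Fin m) (Fin n) ℝ) (X : Matrix (Fin n) (Fin p) ℝ) :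
    (Xᵀ * (Aᵀ * A) * X).rank = (A * X).rank := by
  rw [← rank_transpose_mul_self (A * X)]
  simp only [transpose_mul, Matrix.mul_assoc]

/-- If `A X` has neither full column rank nor the rank of `A`, a column of a suitable frame of `X`
is annihilated by `A`, and turning it into the right orthogonal direction increases the rank. -/
theorem exists_rank_lt_updateCol (hX : X ∈ stiefel n p) (hp : (A * X).rank < p)
    (hA : (A * X).rank < A.rank) :
    ∃ (Q : Matrix (Fin p) (Fin p) ℝ) (μ : Fin p → ℝ) (j : Fin p) (y : Fin n → ℝ),
      Qᵀ * Q = 1 ∧ (X * Q)ᵀ * (Aᵀ * A) * (X * Q) = diagonal μ ∧ y ⬝ᵥ y = 1 ∧ Xᵀ *ᵥ y = 0 ∧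
      ∀ a b : ℝ, b ≠ 0 →
        (A * X).rank < (A * (X * Q).updateCol j (a • (X * Q).col j + b • y)).rank := by
  have hXX : Xᵀ * X = 1 := hX
  obtain ⟨Q, μ, hQ, -, hd⟩ :=
    exists_orthogonal_diagonalisation ((posSemidef_gram A).gram X).transpose_eq
  rw [← gram_mul] at hd
  have hcard := rank_gram_eq_card hQ hd
  rw [rank_gram] at hcard
  obtain ⟨j, hj⟩ : ∃ j, μ j = 0 := by
    by_contra! hne
    rw [Finset.filter_true_of_mem fun k _ => hne k, Finset.card_univ, Fintype.card_fin] at hcard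
    omega
  set Z := X * Q with hZ
  have hAz : A *ᵥ Z.col j = 0 := by
    have h1 : (A *ᵥ Z.col j) ⬝ᵥ (A *ᵥ Z.col j) = 0 := by
      rw [← hj, ← diagonal_apply_eq μ j, ← hd, gram_apply, ← mulVec_mulVec,
        dotProduct_mulVec (Z.col j), vecMul_transpose]
    exact dotProduct_self_eq_zero.1 h1
  have hrange : LinearMap.range (A * Z).mulVecLin = LinearMap.range (A * X).mulVecLin := by
    rw [hZ, ← Matrix.mul_assoc, range_mulVecLin_mul_orthogonal (A * X) hQ]
  obtain ⟨v, hv⟩ : ∃ v, A *ᵥ v ∉ LinearMap.range (A * X).mulVecLin := by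
    by_contra! hall
    have hle : LinearMap.range A.mulVecLin ≤ LinearMap.range (A * X).mulVecLin := by
      rintro _ ⟨v, rfl⟩
      exact hall v
    have := Submodule.finrank_mono hle
    exact absurd hA (not_lt.2 this)
  set y₀ := v - X *ᵥ (Xᵀ *ᵥ v) with hy₀
  have hAy₀ : A *ᵥ y₀ ∉ LinearMap.range (A * X).mulVecLin := by
    intro hmem
    apply hv
    have h1 : A *ᵥ v = A *ᵥ y₀ + (A * X) *ᵥ (Xᵀ *ᵥ v) := by
      rw [hy₀, mulVec_sub, ← mulVec_mulVec, sub_add_cancel]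
    rw [h1]
    exact Submodule.add_mem _ hmem ⟨_, rfl⟩
  have hXy₀ : Xᵀ *ᵥ y₀ = 0 := by
    rw [hy₀, mulVec_sub, mulVec_mulVec, hXX, one_mulVec, sub_self]
  have hy0 : y₀ ≠ 0 := by
    intro h0
    apply hAy₀
    rw [h0, mulVec_zero]
    exact Submodule.zero_mem _
  have hyy : 0 < y₀ ⬝ᵥ y₀ := lt_of_le_of_ne (Finset.sum_nonneg fun i _ => mul_self_nonneg _)
    fun h0 => hy0 (dotProduct_self_eq_zero.1 h0.symm)
  have hs : Real.sqrt (y₀ ⬝ᵥ y₀) ≠ 0 := (Real.sqrt_pos.2 hyy).ne'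
  have hsq := Real.mul_self_sqrt hyy.le
  refine ⟨Q, μ, j, (Real.sqrt (y₀ ⬝ᵥ y₀))⁻¹ • y₀, hQ, hd, ?_, ?_, ?_⟩
  · rw [smul_dotProduct, dotProduct_smul, smul_eq_mul, smul_eq_mul]
    nth_rewrite 3 [← hsq]
    field_simp
  · rw [mulVec_smul, hXy₀, smul_zero]
  · intro a b hb
    set u := a • Z.col j + b • (Real.sqrt (y₀ ⬝ᵥ y₀))⁻¹ • y₀ with hu
    have hcol : ∀ (Y : Matrix (Fin n) (Fin p) ℝ) k, (A * Y).col k = A *ᵥ Y.col k := fun _ _ => rfl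
    have hmem : ∀ k, A *ᵥ (Z.updateCol j u).col k
        ∈ LinearMap.range (A * Z.updateCol j u).mulVecLin := fun k =>
      ⟨Pi.single k 1, by rw [mulVecLin_apply, mulVec_single_one, hcol]⟩
    have hle : LinearMap.range (A * X).mulVecLin
        ≤ LinearMap.range (A * Z.updateCol j u).mulVecLin := by
      rw [← hrange, range_mulVecLin (A * Z), Submodule.span_le]
      rintro _ ⟨k, rfl⟩
      rw [hcol]
      by_cases hk : k = j
      · rw [hk, hAz]
        exact Submodule.zero_mem _
      · have := hmem k
        rwa [col_updateCol_ne _ _ hk] at this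
    have hAu : A *ᵥ u = (b * (Real.sqrt (y₀ ⬝ᵥ y₀))⁻¹) • A *ᵥ y₀ := by
      rw [hu, mulVec_add, mulVec_smul, hAz, smul_zero, zero_add, mulVec_smul, mulVec_smul,
        smul_smul]
    have hlt : LinearMap.range (A * X).mulVecLin
        < LinearMap.range (A * Z.updateCol j u).mulVecLin := by
      refine lt_of_le_of_ne hle fun heq => hAy₀ ?_
      have h1 := hmem j
      rw [col_updateCol_self, hAu, ← heq] at h1
      exact (Submodule.smul_mem_iff _ (mul_ne_zero hb (inv_ne_zero hs))).1 h1
    exact Submodule.finrank_lt_finrank_of_lt hlt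

/-- A local maximiser of `g_w(Xᵀ Aᵀ A X)` is not on the minimal level `w 0`: every neighbourhood
contains points `Y` at which `A Y` has rank at least `q`. -/
theorem conicSymm_ne_of_isLocalMaxOn (hw : ∀ q, 0 ≤ w q)
    (hA : ∃ q : Fin (p + 1), 1 ≤ (q : ℕ) ∧ w q ≠ 0 ∧ (q : ℕ) ≤ A.rank) (hX : X ∈ stiefel n p)
    (h : IsLocalMaxOn (fun X => conicSymm w (Xᵀ * (Aᵀ * A) * X)) (stiefel n p) X) :
    conicSymm w (Xᵀ * (Aᵀ * A) * X) ≠ w 0 := by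
  obtain ⟨q, hq, hwq, hqA⟩ := hA
  -- no point of the manifold has a neighbourhood on which `g_w` is constantly `w 0`
  have key : ∀ k : ℕ, ∀ Y ∈ stiefel n p, p ≤ (A * Y).rank + k →
      ¬ ∀ᶠ Y' in nhdsWithin Y (stiefel n p), conicSymm w (Y'ᵀ * (Aᵀ * A) * Y') = w 0 := by
    have hlarge : ∀ Y ∈ stiefel n p, (q : ℕ) ≤ (A * Y).rank →
        ¬ ∀ᶠ Y' in nhdsWithin Y (stiefel n p), conicSymm w (Y'ᵀ * (Aᵀ * A) * Y') = w 0 := by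
      intro Y hY hr hev
      refine (weight_zero_lt_conicSymm hw ((posSemidef_gram A).gram Y) hq hwq ?_).ne'
        (hev.self_of_nhdsWithin hY)
      rwa [rank_gram]
    intro k
    induction k with
    | zero => exact fun Y hY hr => hlarge Y hY (by omega)
    | succ k ih =>
      intro Y hY hr hev
      rcases le_or_gt (q : ℕ) (A * Y).rank with hle | hlt
      · exact hlarge Y hY hle hev
      obtain ⟨Q, μ, j, y, hQ, -, hy, hYy, hrank⟩ :=
        exists_rank_lt_updateCol (A := A) hY (by omega) (by omega)
      have hQ' : Qᵀᵀ * Qᵀ = 1 := by rw [transpose_transpose]; exact mul_eq_one_comm.1 hQ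
      obtain ⟨t, ht, hevt⟩ := exists_sin_pos_of_eventually
        ((tendsto_rotationCurve hY hQ j hy hYy).eventually
          (eventually_eventually_nhdsWithin.2 hev))
      refine ih _ (rotationCurve_mem_stiefel hY hQ j hy hYy t) ?_ hevt
      have h1 := hrank (Real.cos t) (Real.sin t) ht.ne'
      have h2 : (A * rotationCurve Y Q j y t).rank
          = (A * (Y * Q).updateCol j (Real.cos t • (Y * Q).col j + Real.sin t • y)).rank := by
        rw [rotationCurve, ← Matrix.mul_assoc,
          rank_mul_eq_left_of_isUnit_det _ _ (Matrix.isUnit_det_of_left_inverse hQ')]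
      omega
  intro heq
  refine key p X hX (Nat.le_add_left _ _) ?_
  filter_upwards [h] with Y hY
  have h1 := weight_zero_le_conicSymm hw ((posSemidef_gram A).gram Y)
  exact le_antisymm (hY.trans heq.le) h1

end Rank

/-! ### The optimisation problem over the Stiefel manifold -/

section Problem

variable {m n p : ℕ} {A : Matrix (Fin m) (Fin n) ℝ} {w : Fin (p + 1) → ℝ}
  {X Y : Matrix (Fin n) (Fin p) ℝ}

theorem IsLocalMaxOn.isDominant (hpn : p ≤ n) (hw : ∀ q, 0 ≤ w q)
    (hA : ∃ q : Fin (p + 1), 1 ≤ (q : ℕ) ∧ w q ≠ 0 ∧ (q : ℕ) ≤ A.rank) (hX : X ∈ stiefel n p)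
    (h : IsLocalMaxOn (fun X => conicSymm w (Xᵀ * (Aᵀ * A) * X)) (stiefel n p) X) :
    IsDominant hpn (Aᵀ * A) X :=
  (isLocalMaxOn_columnStationary (posSemidef_gram A) hX h).isDominant hpn
    (isLocalMaxOn_columnMaximal (posSemidef_gram A) hX h) hw (posSemidef_gram A) hX
    (conicSymm_ne_of_isLocalMaxOn hw hA hX h)

/-- Dominant frames are global maximisers: by compactness there is a global maximiser, it is
dominant, and all dominant frames give the same value. -/
theorem IsDominant.isMaxOn {hpn : p ≤ n} (hw : ∀ q, 0 ≤ w q)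
    (hA : ∃ q : Fin (p + 1), 1 ≤ (q : ℕ) ∧ w q ≠ 0 ∧ (q : ℕ) ≤ A.rank) (hX : X ∈ stiefel n p)
    (h : IsDominant hpn (Aᵀ * A) X) :
    IsMaxOn (fun X => conicSymm w (Xᵀ * (Aᵀ * A) * X)) (stiefel n p) X := by
  obtain ⟨Y, hY, hmax⟩ := exists_isMaxOn_stiefel hpn w (Aᵀ * A)
  obtain ⟨R, hR, hsim⟩ :=
    h.exists_similar hX hY (IsLocalMaxOn.isDominant hpn hw hA hY hmax.localize)
  intro Z hZ
  have h1 := hmax hZ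
  simp only [Set.mem_ofPred_eq] at h1 ⊢
  rwa [hsim, conicSymm_conj w _ hR] at h1

theorem conicSymm_one_pos (hw : ∀ q, 0 ≤ w q) (hwq : ∃ q : Fin (p + 1), 1 ≤ (q : ℕ) ∧ w q ≠ 0) :
    0 < conicSymm w (1 : Matrix (Fin p) (Fin p) ℝ) := by
  obtain ⟨q, hq, hwq⟩ := hwq
  refine (hw 0).trans_lt (weight_zero_lt_conicSymm hw PosSemidef.one hq hwq ?_)
  rw [rank_one, Fintype.card_fin]
  exact Nat.lt_succ_iff.1 q.2

theorem conicObjective_le_iff (hc : 0 < conicSymm w (1 : Matrix (Fin p) (Fin p) ℝ))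
    (hX : X ∈ stiefel n p) (hY : Y ∈ stiefel n p) :
    conicObjective A w X ≤ conicObjective A w Y ↔
      conicSymm w (Xᵀ * (Aᵀ * A) * X) ≤ conicSymm w (Yᵀ * (Aᵀ * A) * Y) := by
  rw [conicObjective_of_mem_stiefel hX, conicObjective_of_mem_stiefel hY,
    div_le_div_iff_of_pos_right hc]

theorem isMaxOn_conicObjective_iff (hc : 0 < conicSymm w (1 : Matrix (Fin p) (Fin p) ℝ))
    (hX : X ∈ stiefel n p) : IsMaxOn (conicObjective A w) (stiefel n p) X ↔
      IsMaxOn (fun X => conicSymm w (Xᵀ * (Aᵀ * A) * X)) (stiefel n p) X :=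
  forall₂_congr fun _ hY => conicObjective_le_iff hc hY hX

theorem isLocalMaxOn_conicObjective_iff (hc : 0 < conicSymm w (1 : Matrix (Fin p) (Fin p) ℝ))
    (hX : X ∈ stiefel n p) : IsLocalMaxOn (conicObjective A w) (stiefel n p) X ↔
      IsLocalMaxOn (fun X => conicSymm w (Xᵀ * (Aᵀ * A) * X)) (stiefel n p) X := by
  refine Filter.eventually_congr ?_
  filter_upwards [self_mem_nhdsWithin] with Y hY
  exact conicObjective_le_iff hc hY hX

section Multiplier

variable {Λ : Matrix (Fin p) (Fin p) ℝ}

theorem IsStiefelMultiplier.columnStationary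
    (hΛ : IsStiefelMultiplier (conicObjective A w) X Λ) (hw : ∀ q, 0 ≤ w q)
    (hc : 0 < conicSymm w (1 : Matrix (Fin p) (Fin p) ℝ)) (hX : X ∈ stiefel n p) :
    ColumnStationary w (Aᵀ * A) X := fun _ _ j _ hQ hd hy hXy =>
  (stiefelMultiplier_columnVariation hΛ hw hc hX hQ hd
    (nonneg_of_gram_eq_diagonal (posSemidef_gram A) hd) j hy hXy).1

theorem hasAscentDirection_of_lt (hΛ : IsStiefelMultiplier (conicObjective A w) X Λ)
    (hw : ∀ q, 0 ≤ w q) (hc : 0 < conicSymm w (1 : Matrix (Fin p) (Fin p) ℝ))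
    (hX : X ∈ stiefel n p) {Q : Matrix (Fin p) (Fin p) ℝ} {μ : Fin p → ℝ} (hQ : Qᵀ * Q = 1)
    (hd : (X * Q)ᵀ * (Aᵀ * A) * (X * Q) = diagonal μ) {j : Fin p} {y : Fin n → ℝ}
    (hy : y ⬝ᵥ y = 1) (hXy : Xᵀ *ᵥ y = 0)
    (hlt : conicSymm w (Xᵀ * (Aᵀ * A) * X)
      < conicSymm w (((X * Q).updateCol j y)ᵀ * (Aᵀ * A) * (X * Q).updateCol j y)) :
    HasAscentDirection (conicObjective A w) X := by
  obtain ⟨-, htan, hhess⟩ := stiefelMultiplier_columnVariation hΛ hw hc hX hQ hd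
    (nonneg_of_gram_eq_diagonal (posSemidef_gram A) hd) j hy hXy
  refine ⟨Λ, _, hΛ, htan, ?_⟩
  rw [hhess]
  exact mul_pos two_pos (div_pos (sub_pos.2 hlt) hc)

theorem columnMaximal_of_not_hasAscentDirection
    (hΛ : IsStiefelMultiplier (conicObjective A w) X Λ) (hw : ∀ q, 0 ≤ w q)
    (hc : 0 < conicSymm w (1 : Matrix (Fin p) (Fin p) ℝ)) (hX : X ∈ stiefel n p)
    (h : ¬ HasAscentDirection (conicObjective A w) X) : ColumnMaximal w (Aᵀ * A) X := by
  intro Q μ j y hQ hd hy hXy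
  by_contra hlt
  exact h (hasAscentDirection_of_lt hΛ hw hc hX hQ hd hy hXy (not_le.1 hlt))

theorem columnMaximal_neg_of_not_hasDescentDirection
    (hΛ : IsStiefelMultiplier (conicObjective A w) X Λ) (hw : ∀ q, 0 ≤ w q)
    (hc : 0 < conicSymm w (1 : Matrix (Fin p) (Fin p) ℝ)) (hX : X ∈ stiefel n p)
    (h : ¬ HasDescentDirection (conicObjective A w) X) : ColumnMaximal (-w) (Aᵀ * A) X := by
  intro Q μ j y hQ hd hy hXy
  rw [conicSymm_neg, conicSymm_neg, neg_le_neg_iff]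
  by_contra hlt
  obtain ⟨-, htan, hhess⟩ := stiefelMultiplier_columnVariation hΛ hw hc hX hQ hd
    (nonneg_of_gram_eq_diagonal (posSemidef_gram A) hd) j hy hXy
  refine h ⟨Λ, _, hΛ, htan, ?_⟩
  rw [hhess]
  exact mul_neg_of_pos_of_neg two_pos (div_neg_of_neg_of_pos (sub_neg.2 (not_le.1 hlt)) hc)

/-- Stationary points above the minimal level `w 0`. -/
theorem isStrictSaddle_of_ne (hpn : p ≤ n)
    (hΛ : IsStiefelMultiplier (conicObjective A w) X Λ) (hw : ∀ q, 0 ≤ w q)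
    (hA : ∃ q : Fin (p + 1), 1 ≤ (q : ℕ) ∧ w q ≠ 0 ∧ (q : ℕ) ≤ A.rank) (hX : X ∈ stiefel n p)
    (hne : conicSymm w (Xᵀ * (Aᵀ * A) * X) ≠ w 0)
    (hloc : ¬ IsLocalMaxOn (conicObjective A w) (stiefel n p) X) :
    IsStrictSaddle (conicObjective A w) X := by
  have hwq : ∃ q : Fin (p + 1), 1 ≤ (q : ℕ) ∧ w q ≠ 0 := by
    obtain ⟨q, hq, hwq, -⟩ := hA
    exact ⟨q, hq, hwq⟩
  have hc := conicSymm_one_pos hw hwq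
  have hst := hΛ.columnStationary hw hc hX
  refine ⟨⟨hX, Λ, hΛ⟩, ?_, ?_⟩
  · by_contra hno
    have hdom := hst.isDominant hpn (columnMaximal_of_not_hasAscentDirection hΛ hw hc hX hno) hw
      (posSemidef_gram A) hX hne
    exact hloc ((isMaxOn_conicObjective_iff hc hX).2 (hdom.isMaxOn hw hA hX)).localize
  · by_contra! hno
    have hdom := hst.isDominant_neg hpn
      (columnMaximal_neg_of_not_hasDescentDirection hΛ hw hc hX hno.2) hw (posSemidef_gram A) hX hne
    have hmin := hdom.isMinOn hw hwq (posSemidef_gram A) hX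
    have hmin' : IsMinOn (conicObjective A w) (stiefel n p) X := fun Y hY =>
      (conicObjective_le_iff hc hX hY).2 (hmin hY)
    exact hno.1 hmin'.localize

/-- Stationary points on the minimal level `w 0` are global minimisers. The rank condition makes
`q = rank (A X) + 1` admissible, so that a single rank-increasing column replacement leaves this
level. -/
theorem isStrictSaddle_of_eq (hΛ : IsStiefelMultiplier (conicObjective A w) X Λ)
    (hw : ∀ q, 0 ≤ w q)
    (hA : ∃ q : Fin (p + 1), 1 ≤ (q : ℕ) ∧ w q ≠ 0 ∧ (q : ℕ) ≤ A.rank) (hX : X ∈ stiefel n p)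
    (heq : conicSymm w (Xᵀ * (Aᵀ * A) * X) = w 0)
    (hr : ∃ q : Fin (p + 1), 1 ≤ (q : ℕ) ∧ w q ≠ 0 ∧ (q : ℕ) ≤ (A * X).rank + 1) :
    IsStrictSaddle (conicObjective A w) X := by
  have hwq : ∃ q : Fin (p + 1), 1 ≤ (q : ℕ) ∧ w q ≠ 0 := by
    obtain ⟨q, hq, hwq, -⟩ := hA
    exact ⟨q, hq, hwq⟩
  have hc := conicSymm_one_pos hw hwq
  have hrank : ∀ q : Fin (p + 1), 1 ≤ (q : ℕ) → w q ≠ 0 → (A * X).rank < q := by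
    intro q hq hwq
    by_contra hle
    refine (weight_zero_lt_conicSymm hw ((posSemidef_gram A).gram X) hq hwq ?_).ne' heq
    rw [rank_gram]
    exact not_lt.1 hle
  refine ⟨⟨hX, Λ, hΛ⟩, ?_, Or.inl ?_⟩
  · obtain ⟨q, hq, hwq, hqr⟩ := hr
    obtain ⟨q', hq', hwq', hqA⟩ := hA
    have h1 := hrank q hq hwq
    have h2 := hrank q' hq' hwq'
    have h3 : (q : ℕ) ≤ p := Nat.lt_succ_iff.1 q.2
    obtain ⟨Q, μ, j, y, hQ, hd, hy, hXy, hup⟩ :=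
      exists_rank_lt_updateCol (A := A) hX (by omega) (by omega)
    refine hasAscentDirection_of_lt hΛ hw hc hX hQ hd (j := j) hy hXy ?_
    rw [heq]
    refine weight_zero_lt_conicSymm hw ((posSemidef_gram A).gram _) hq hwq ?_
    have h4 := hup 0 1 one_ne_zero
    rw [zero_smul, zero_add, one_smul] at h4
    rw [rank_gram]
    omega
  · have hmin : IsMinOn (conicObjective A w) (stiefel n p) X := fun Y hY =>
      (conicObjective_le_iff hc hX hY).2
        (heq.le.trans (weight_zero_le_conicSymm hw ((posSemidef_gram A).gram Y)))
    exact hmin.localize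

end Multiplier

end Problem

end

theorem corollary4p2 {m n p : ℕ} (hpn : p ≤ n) (A : Matrix (Fin m) (Fin n) ℝ)
    (w : Fin (p + 1) → ℝ) (hw : ∀ q, 0 ≤ w q)
    (hA : ∃ q : Fin (p + 1), 1 ≤ (q : ℕ) ∧ w q ≠ 0 ∧ (q : ℕ) ≤ A.rank) :
    -- global maximisers
    (∀ X : Matrix (Fin n) (Fin p) ℝ,
      (X ∈ stiefel n p ∧ IsMaxOn (conicObjective A w) (stiefel n p) X) ↔
        (X ∈ stiefel n p ∧ ∃ Vp : Matrix (Fin n) (Fin p) ℝ,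
          IsLeadingRightSingularFactor hpn A Vp ∧
          LinearMap.range X.mulVecLin = LinearMap.range Vp.mulVecLin)) ∧
    -- local maximisers are global maximisers
    (∀ X ∈ stiefel n p, IsLocalMaxOn (conicObjective A w) (stiefel n p) X →
      IsMaxOn (conicObjective A w) (stiefel n p) X) ∧
    -- all other stationary points are strict saddle points
    (∀ X : Matrix (Fin n) (Fin p) ℝ, IsStiefelStationary (conicObjective A w) X →
      ¬ IsLocalMaxOn (conicObjective A w) (stiefel n p) X →
      (∃ q : Fin (p + 1), 1 ≤ (q : ℕ) ∧ w q ≠ 0 ∧ (q : ℕ) ≤ (A * X).rank + 1) →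
      IsStrictSaddle (conicObjective A w) X) := by
  have hc : 0 < conicSymm w (1 : Matrix (Fin p) (Fin p) ℝ) := by
    obtain ⟨q, hq, hwq, -⟩ := hA
    exact conicSymm_one_pos hw ⟨q, hq, hwq⟩
  have hdom : ∀ X ∈ stiefel n p, IsLocalMaxOn (conicObjective A w) (stiefel n p) X →
      IsDominant hpn (Aᵀ * A) X := fun X hX h =>
    IsLocalMaxOn.isDominant hpn hw hA hX ((isLocalMaxOn_conicObjective_iff hc hX).1 h)
  have hmax : ∀ X ∈ stiefel n p, IsDominant hpn (Aᵀ * A) X →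
      IsMaxOn (conicObjective A w) (stiefel n p) X := fun X hX h =>
    (isMaxOn_conicObjective_iff hc hX).2 (h.isMaxOn hw hA hX)
  refine ⟨fun X => ⟨?_, ?_⟩, fun X hX h => hmax X hX (hdom X hX h), ?_⟩
  · rintro ⟨hX, h⟩
    exact ⟨hX, (hdom X hX h.localize).exists_isLeadingRightSingularFactor⟩
  · rintro ⟨hX, Vp, hVp, hr⟩
    exact ⟨hX, hmax X hX (hVp.isDominant hr)⟩
  · rintro X ⟨hX, Λ, hΛ⟩ hloc hr
    by_cases heq : conicSymm w (Xᵀ * (Aᵀ * A) * X) = w 0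
    · exact isStrictSaddle_of_eq hΛ hw hA hX heq hr
    · exact isStrictSaddle_of_ne hpn hΛ hw hA hX heq hloc
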